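/- Let $\theta\in\mathbb{R}^n$, let $C\in\mathbb{R}$ and $\beta>0$, and consider the system $y_k=\phi_k^\top\theta+d_k$, $k\ge 1$, with deterministic regressors $\phi_k\in\mathbb{R}^n$ and binary observations $s_k=I_{\{y_k\le C\}}$. Assume the following. (A1) $\sup_{k\ge1}\|\phi_k\|\le M<\infty$, and there are a positive integer $N\ge n$ and a real number $\delta>0$ with $\frac1N\sum_{i=k}^{k+N-1}\phi_i\phi_i^\top\ge\delta I_n$ for all $k\ge1$ (in the order of symmetric matrices). (A2) The noise $\{d_k,k\ge1\}$ is i.i.d. with zero mean and finite variance; its distribution function $F$ is Lipschitz continuous, and its density function $f$ satisfies $\inf_{x\in\mathfrak X}f(x)>0$ for every bounded open set $\mathfrak X\subset\mathbb{R}$. Let $\hat\theta_0$ be an arbitrary (possibly random) initial value, and for $k\ge1$ let $$\hat\theta_k=\hat\theta_{k-1}+\frac{\beta\phi_k}{k}\left(F(C-\phi_k^\top\hat\theta_{k-1})-s_k\right),\qquad T_k=\frac1k\sum_{i=1}^k\beta\phi_i\left(F(C-\phi_i^\top\theta)-s_i\right).$$ Let $\psi_k=(\hat\theta_k-\theta)-T_k$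 (the stochastic process with averaged observations, SPAO). Let $$\underline f=\lim_{z\to(M\|\theta\|)^+}\ \inf_{t\in[C-z,C+z]}f(t),\qquad \eta=\beta\delta\underline f .$$ Then, for every $\varepsilon>0$, almost surely as $k\to\infty$, $$\psi_k=\begin{cases}O\left(\sqrt{\frac{\ln\ln k}{k}}\right),&\eta>\frac12;\\ O\left(\frac1{k^{\eta-\varepsilon}}\right),&\eta\le\frac12.\end{cases}$$ If moreover $f$ is locally Lipschitz continuous, then almost surely as $k\to\infty$, $$\psi_k=\begin{cases}O\left(\sqrt{\frac{\ln\ln k}{k}}\right),&\eta>\frac12;\\ O\left(\ln k\sqrt{\frac{\ln\ln k}{k}}\right),&\eta=\frac12;\\ O\left(\frac1{k^{\eta}}\right),&\eta<\frac12.\end{cases}$$ -/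

import Mathlib

open Set Filter Topology MeasureTheory ProbabilityTheory Asymptotics

namespace SetValued

/-- Uniformly bounded, uniformly persistently exciting regressors `φ k`, `k ≥ 1`
(`φ 0` is not used): `‖φ k‖ ≤ M` and `(1/N) ∑_{i=k}^{k+N-1} φ i (φ i)ᵀ ≥ δ I_n` in the
Loewner order, where `N ≥ n` is a positive integer and `δ > 0`. -/
structure PersistentExcitation {n : ℕ} (φ : ℕ → EuclideanSpace ℝ (Fin n))
    (M δ : ℝ) (N : ℕ) : Prop where
  bounded : ∀ k, 1 ≤ k → ‖φ k‖ ≤ M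
  window_pos : 1 ≤ N
  window_ge : n ≤ N
  delta_pos : 0 < δ
  excitation : ∀ k, 1 ≤ k →
    ((1 / (N : ℝ)) • (∑ i ∈ Finset.Ico k (k + N), Matrix.vecMulVec (φ i).ofLp (φ i).ofLp)
      - δ • (1 : Matrix (Fin n) (Fin n) ℝ)).PosSemidef

/-- The distribution function `F` of the noise sequence `d k`, `k ≥ 1` (the law of `d 1`). -/
noncomputable def noiseCDF {Ω : Type*} [MeasurableSpace Ω] (μ : Measure Ω)
    (d : ℕ → Ω → ℝ) (x : ℝ) : ℝ :=
  cdf (μ.map (d 1)) x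

/-- The noise `d k`, `k ≥ 1` (`d 0` is not used): i.i.d., zero mean, finite variance, Lipschitz
distribution function, and a density function `f` which has a positive infimum on every bounded
open set. -/
structure NoiseAssumption {Ω : Type*} [MeasurableSpace Ω] (μ : Measure Ω)
    (d : ℕ → Ω → ℝ) (f : ℝ → ℝ) : Prop where
  indep : iIndepFun (fun k : ℕ => d (k + 1)) μ
  identDistrib : ∀ k, 1 ≤ k → IdentDistrib (d k) (d 1) μ μ
  memLp_two : MemLp (d 1) 2 μ
  mean_zero : ∫ ω, d 1 ω ∂μ = 0
  cdf_lipschitz : ∃ K, LipschitzWith K (noiseCDF μ d)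
  density_aemeasurable : AEMeasurable f volume
  density : μ.map (d 1) = volume.withDensity (fun x => ENNReal.ofReal (f x))
  density_pos : ∀ X : Set ℝ, IsOpen X → Bornology.IsBounded X → ∃ c > 0, ∀ x ∈ X, c ≤ f x

section System

variable {Ω : Type*} [MeasurableSpace Ω] {n : ℕ} (μ : Measure Ω)
  (d : ℕ → Ω → ℝ) (φ : ℕ → EuclideanSpace ℝ (Fin n)) (θ : EuclideanSpace ℝ (Fin n)) (C β : ℝ)
  (θ₀ : Ω → EuclideanSpace ℝ (Fin n))

/-- The unobserved output `y k = (φ k)ᵀ θ + d k`. -/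
noncomputable def output (k : ℕ) (ω : Ω) : ℝ :=
  inner ℝ (φ k) θ + d k ω

open Classical in
/-- The binary observation `s k = I_{y k ≤ C}`. -/
noncomputable def observation (k : ℕ) (ω : Ω) : ℝ :=
  if output d φ θ k ω ≤ C then 1 else 0

/-- The stochastic approximation estimates started at `θ₀`: for `k ≥ 1`,
`θhat k = θhat (k-1) + (β φ k / k) (F (C - (φ k)ᵀ θhat (k-1)) - s k)`. -/
noncomputable def estimate : ℕ → Ω → EuclideanSpace ℝ (Fin n)
  | 0, ω => θ₀ ω
  | k + 1, ω =>
    estimate k ω +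
      (β / ((k + 1 : ℕ) : ℝ) *
        (noiseCDF μ d (C - inner ℝ (φ (k + 1)) (estimate k ω))
          - observation d φ θ C (k + 1) ω)) • φ (k + 1)

/-- `T k = (∑_{i=1}^k β φ i (F i - s i)) / k`, with `F i = F (C - (φ i)ᵀ θ)`. -/
noncomputable def averagedNoise (k : ℕ) (ω : Ω) : EuclideanSpace ℝ (Fin n) :=
  (1 / (k : ℝ)) • ∑ i ∈ Finset.Icc 1 k,
    (β * (noiseCDF μ d (C - inner ℝ (φ i) θ) - observation d φ θ C i ω)) • φ i

/-- The stochastic process with averaged observations: `ψ k = (θhat k - θ) - T k`. -/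
noncomputable def spao (k : ℕ) (ω : Ω) : EuclideanSpace ℝ (Fin n) :=
  (estimate μ d φ θ C β θ₀ k ω - θ) - averagedNoise μ d φ θ C β k ω

end System

/-- The right limit, as `z ↓ M ‖θ‖ + x`, of `inf_{t ∈ [C - z, C + z]} f t`. -/
noncomputable def lowerDensity {n : ℕ} (f : ℝ → ℝ) (C M : ℝ) (θ : EuclideanSpace ℝ (Fin n))
    (x : ℝ) : ℝ :=
  Function.rightLim (fun z : ℝ => sInf (f '' Icc (C - z) (C + z))) (M * ‖θ‖ + x)

/-- The limit in the definition of `lowerDensity` exists. -/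
theorem tendsto_lowerDensity {n : ℕ} {f : ℝ → ℝ} (hf : ∀ t, 0 ≤ f t) (C : ℝ) {M : ℝ}
    (hM : 0 ≤ M) (θ : EuclideanSpace ℝ (Fin n)) {x : ℝ} (hx : 0 ≤ x) :
    Tendsto (fun z : ℝ => sInf (f '' Icc (C - z) (C + z))) (𝓝[>] (M * ‖θ‖ + x))
      (𝓝 (lowerDensity f C M θ x)) := by
  have hr : 0 ≤ M * ‖θ‖ + x := by positivity
  set r := M * ‖θ‖ + x with hrdef
  set G : ℝ → ℝ := fun z => sInf (f '' Icc (C - z) (C + z)) with hG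
  have hbdd : ∀ z, BddBelow (f '' Icc (C - z) (C + z)) := fun z =>
    ⟨0, by rintro _ ⟨t, -, rfl⟩; exact hf t⟩
  have hanti : ∀ a b : ℝ, 0 ≤ a → a ≤ b → G b ≤ G a := fun a b ha hab =>
    csInf_le_csInf (hbdd b) ⟨f C, C, ⟨by linarith, by linarith⟩, rfl⟩
      (image_mono (Icc_subset_Icc (by linarith) (by linarith)))
  have hanti' : Antitone (fun z => G (max z 0)) := fun a b hab =>
    hanti _ _ (le_max_right _ _) (max_le_max_right _ hab)
  have heq : (fun z => G (max z 0)) =ᶠ[𝓝[>] r] G := by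
    filter_upwards [self_mem_nhdsWithin] with z hz
    rw [max_eq_left (hr.trans (le_of_lt hz))]
  have ht : Tendsto G (𝓝[>] r) (𝓝 (Function.rightLim (fun z => G (max z 0)) r)) :=
    (hanti'.tendsto_rightLim r).congr' heq
  have : lowerDensity f C M θ x = Function.rightLim (fun z => G (max z 0)) r :=
    rightLim_eq_of_tendsto ht
  rw [this]
  exact ht

end SetValued

/-! Subtracting `averagedNoise` removes the raw observations from the recursion. Both the estimate
and the running average absorb `s k` with step `1 / k`, so in `spao` it cancels. What remains is `ψ
(k+1) = ψ k - (a (k+1) / (k+1)) ⟪φ, ψ k + T k⟫ φ + T k / (k+1)`, where the gain `a` is `β` times a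
secant slope of the noise distribution function (`spao_succ`). Randomness now enters only through
`T`, which is `O(√(ln ln k / k))` almost surely (`NoiseAssumption.averagedNoise_isBigO`); the rest
is deterministic, path by path.

A single step contracts only along `φ (k+1)`, but by persistent excitation `N` consecutive steps
contract in every direction: the norm is multiplied by at most `1 - N δ α / m + O(1 / m ^ 2)` when
the gain is at least `α`, with an added perturbation of order `lilScale m / m`
(`exists_norm_window_le`). Rates follow by comparison with explicit supersolutions of this delayed
scalar recursion (`isBigO_of_supersolution`).

The gain has no a priori positive lower bound, since the secant may be long. But the error grows at
most like `log k`, so the gain is at least a multiple of `1 / log k`; because `∑ 1 / (k log k)`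
diverges, the error tends to zero. The secants then shrink, and the gain eventually exceeds every
number below `β` times `lowerDensity f C M θ 0`. This gives every contraction rate below `η`, hence
the first set of bounds. For a locally Lipschitz density, a preliminary polynomial rate is fed back:
the gain falls short of its limiting bound by only `O(k ^ (-γ))`, a summable correction after
division by `k`, so the exact rate `η` is reached, with an additional logarithm at the resonance `η
= 1 / 2`. -/

namespace SetValued

/-! ### Upper half of the law of the iterated logarithm for bounded variables. -/

section MaximalInequality

variable {Ω : Type*} [mΩ : MeasurableSpace Ω] {μ : Measure Ω} [IsProbabilityMeasure μ]
  {X : ℕ → Ω → ℝ} {B : ℝ}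

/-- The exponential of a multiple of the partial sums of bounded centred independent variables is
a submartingale. -/
theorem submartingale_exp_sum (hX : ∀ i, StronglyMeasurable (X i)) (hind : iIndepFun X μ)
    (hB : ∀ i ω, |X i ω| ≤ B) (hmean : ∀ i, ∫ ω, X i ω ∂μ = 0) (t : ℝ) :
    Submartingale (fun n ω => Real.exp (t * ∑ i ∈ Finset.range (n + 1), X i ω))
      (Filtration.natural X hX) μ := by
  have hadX := Filtration.stronglyAdapted_natural hX
  have hXint : ∀ i, Integrable (X i) μ := fun i =>
    Integrable.of_bound (hX i).aestronglyMeasurable B (ae_of_all _ (hB i))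
  have hSad : ∀ n, StronglyMeasurable[Filtration.natural X hX n]
      (fun ω => ∑ i ∈ Finset.range (n + 1), X i ω) := by
    intro n
    refine Finset.stronglyMeasurable_fun_sum _ fun i hi => ?_
    exact (hadX i).mono ((Filtration.natural X hX).mono (by simp at hi; omega))
  have hSint : ∀ n, Integrable (fun ω => ∑ i ∈ Finset.range (n + 1), X i ω) μ := fun n =>
    integrable_finsetSum _ fun i _ => hXint i
  have hEsm : ∀ n, StronglyMeasurable[Filtration.natural X hX n]
      (fun ω => Real.exp (t * ∑ i ∈ Finset.range (n + 1), X i ω)) := fun n =>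
    Real.continuous_exp.comp_stronglyMeasurable ((hSad n).const_mul t)
  have hEint : ∀ n, Integrable (fun ω => Real.exp (t * ∑ i ∈ Finset.range (n + 1), X i ω)) μ := by
    intro n
    refine Integrable.of_bound ((hEsm n).mono (Filtration.le _ _)).aestronglyMeasurable
      (Real.exp (|t| * ((n + 1 : ℕ) * B))) (ae_of_all _ fun ω => ?_)
    rw [Real.norm_eq_abs, Real.abs_exp, Real.exp_le_exp]
    refine (le_abs_self _).trans ?_
    rw [abs_mul]
    refine mul_le_mul_of_nonneg_left ?_ (abs_nonneg t)
    refine (Finset.abs_sum_le_sum_abs _ _).trans ((Finset.sum_le_sum fun i _ => hB i ω).trans ?_)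
    simp
  refine submartingale_nat hEsm hEint fun n => ?_
  -- Conditional Jensen: the partial sums form a martingale and `x ↦ exp (t x)` is convex.
  have hconv : ConvexOn ℝ univ fun x : ℝ => Real.exp (t * x) := by
    have := convexOn_exp.comp_linearMap (LinearMap.lsmul ℝ ℝ t)
    simpa [Function.comp_def] using this
  have hjensen := hconv.map_condExp_le_of_finiteDimensional
    ((Filtration.natural X hX).le n) (hSint (n + 1)) (hEint (n + 1))
  have hcond : μ[fun ω => ∑ i ∈ Finset.range (n + 1 + 1), X i ω | Filtration.natural X hX n]
      =ᵐ[μ] fun ω => ∑ i ∈ Finset.range (n + 1), X i ω := by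
    have h1 : (fun ω => ∑ i ∈ Finset.range (n + 1 + 1), X i ω)
        = (fun ω => ∑ i ∈ Finset.range (n + 1), X i ω) + X (n + 1) := by
      ext ω; simp [Finset.sum_range_succ]
    rw [h1]
    refine (condExp_add (hSint n) (hXint (n + 1)) _).trans ?_
    have h2 := iIndepFun.condExp_natural_ae_eq_of_lt hX hind (Nat.lt_succ_self n)
    rw [condExp_of_stronglyMeasurable ((Filtration.natural X hX).le n) (hSad n) (hSint n)]
    filter_upwards [h2] with ω hω
    simp [hω, hmean]
  filter_upwards [hjensen, hcond] with ω h1 h2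
  simp only [Function.comp_def] at h1
  rw [h2] at h1
  exact h1

/-- Maximal form of Hoeffding's inequality. -/
theorem measure_exists_sum_ge_le (hX : ∀ i, StronglyMeasurable (X i)) (hind : iIndepFun X μ)
    (hB0 : 0 < B) (hB : ∀ i ω, |X i ω| ≤ B) (hmean : ∀ i, ∫ ω, X i ω ∂μ = 0) (n : ℕ) {x : ℝ}
    (hx : 0 ≤ x) :
    μ {ω | ∃ k ≤ n, x ≤ ∑ i ∈ Finset.range (k + 1), X i ω} ≤
      ENNReal.ofReal (Real.exp (-x ^ 2 / (2 * (n + 1) * B ^ 2))) := by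
  -- The minimizer of the exponent `-t x + (n + 1) B ^ 2 t ^ 2 / 2`.
  set t : ℝ := x / ((n + 1) * B ^ 2) with ht
  have hn : (0 : ℝ) < n + 1 := by positivity
  have ht0 : 0 ≤ t := by positivity
  have hsub := submartingale_exp_sum hX hind hB hmean t
  have hnonneg : (0 : ℕ → Ω → ℝ) ≤
      fun n ω => Real.exp (t * ∑ i ∈ Finset.range (n + 1), X i ω) :=
    fun n ω => (Real.exp_pos _).le
  set ε : NNReal := Real.toNNReal (Real.exp (t * x)) with hε
  have hεr : (ε : ℝ) = Real.exp (t * x) := Real.coe_toNNReal _ (Real.exp_pos _).le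
  have hmax := maximal_ineq hsub hnonneg (ε := ε) n
  set A := {ω | (ε : ℝ) ≤ (Finset.range (n + 1)).sup' Finset.nonempty_range_add_one
    fun k => Real.exp (t * ∑ i ∈ Finset.range (k + 1), X i ω)} with hA
  have hsubset : {ω | ∃ k ≤ n, x ≤ ∑ i ∈ Finset.range (k + 1), X i ω} ⊆ A := by
    rintro ω ⟨k, hk, hkx⟩
    simp only [hA, mem_ofPred_eq, Finset.le_sup'_iff]
    refine ⟨k, by simp; omega, ?_⟩
    rw [hεr]
    exact Real.exp_le_exp.2 (mul_le_mul_of_nonneg_left hkx ht0)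
  have hmgf : ∫ ω, Real.exp (t * ∑ i ∈ Finset.range (n + 1), X i ω) ∂μ
      ≤ Real.exp ((n + 1) * B ^ 2 * t ^ 2 / 2) := by
    have h := HasSubgaussianMGF.sum_of_iIndepFun hind (s := Finset.range (n + 1))
      (fun i _ => hasSubgaussianMGF_of_mem_Icc_of_integral_eq_zero (a := -B) (b := B)
        (hX i).measurable.aemeasurable (ae_of_all _ fun ω => abs_le.1 (hB i ω)) (hmean i))
    refine (h.mgf_le t).trans_eq ?_
    have : |B + B| = 2 * B := by rw [abs_of_nonneg (by linarith)]; ring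
    simp [this]
  have hint : ∫ ω in A, Real.exp (t * ∑ i ∈ Finset.range (n + 1), X i ω) ∂μ
      ≤ Real.exp ((n + 1) * B ^ 2 * t ^ 2 / 2) :=
    (setIntegral_le_integral (hsub.integrable n)
      (ae_of_all _ fun ω => (Real.exp_pos _).le)).trans hmgf
  have h1 := hmax.trans (ENNReal.ofReal_le_ofReal hint)
  have hεe : (ε : ENNReal) = ENNReal.ofReal (Real.exp (t * x)) := rfl
  have h2 : μ A ≤ ENNReal.ofReal (Real.exp (-(t * x)) * Real.exp ((n + 1) * B ^ 2 * t ^ 2 / 2)) := by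
    calc μ A = ENNReal.ofReal (Real.exp (-(t * x))) * (ε * μ A) := by
          rw [hεe, ← mul_assoc, ← ENNReal.ofReal_mul (Real.exp_pos _).le, ← Real.exp_add]
          simp
      _ ≤ ENNReal.ofReal (Real.exp (-(t * x))) *
          ENNReal.ofReal (Real.exp ((n + 1) * B ^ 2 * t ^ 2 / 2)) := by gcongr
      _ = _ := (ENNReal.ofReal_mul (Real.exp_pos _).le).symm
  refine (measure_mono hsubset).trans (h2.trans_eq ?_)
  rw [← Real.exp_add]
  congr 2
  rw [ht]
  field_simp
  ring

/-- Upper half of the law of the iterated logarithm along dyadic blocks. -/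
theorem ae_eventually_forall_sum_lt (hX : ∀ i, StronglyMeasurable (X i)) (hind : iIndepFun X μ)
    (hB0 : 0 < B) (hB : ∀ i ω, |X i ω| ≤ B) (hmean : ∀ i, ∫ ω, X i ω ∂μ = 0) :
    ∀ᵐ ω ∂μ, ∀ᶠ j : ℕ in atTop, ∀ k < 2 ^ j,
      ∑ i ∈ Finset.range (k + 1), X i ω < 2 * B * Real.sqrt (2 ^ j * Real.log j) := by
  set s : ℕ → Set Ω := fun j => {ω | ∃ k ≤ 2 ^ j - 1,
    2 * B * Real.sqrt (2 ^ j * Real.log j) ≤ ∑ i ∈ Finset.range (k + 1), X i ω} with hs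
  -- At this level the maximal inequality gives `exp (-2 log j) = 1 / j ^ 2`, which is summable for
  -- Borel-Cantelli. The index `0` is separated because `1 / 0 ^ 2` evaluates to `0`.
  have hle : ∀ j, μ (s j) ≤ ENNReal.ofReal (if j = 0 then 1 else 1 / (j : ℝ) ^ 2) := by
    intro j
    split_ifs with hj
    · simpa using prob_le_one
    · refine (measure_exists_sum_ge_le hX hind hB0 hB hmean (2 ^ j - 1) (by positivity)).trans ?_
      apply ENNReal.ofReal_le_ofReal
      have hj1 : (1 : ℝ) ≤ j := by exact_mod_cast Nat.one_le_iff_ne_zero.2 hj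
      have hlog : 0 ≤ Real.log j := Real.log_nonneg hj1
      have hcast : (((2 ^ j - 1 : ℕ) : ℝ) + 1) = 2 ^ j := by
        rw [Nat.cast_sub Nat.one_le_two_pow]; simp
      rw [hcast, mul_pow, Real.sq_sqrt (by positivity)]
      have : -((2 * B) ^ 2 * (2 ^ j * Real.log j)) / (2 * 2 ^ j * B ^ 2)
          = -(2 * Real.log j) := by field_simp
      rw [this, Real.exp_neg, two_mul, Real.exp_add, Real.exp_log (by linarith)]
      simp [sq]
  have hsum : (∑' j, μ (s j)) ≠ ⊤ := by
    refine ne_top_of_le_ne_top ?_ (ENNReal.tsum_le_tsum hle)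
    refine Summable.tsum_ofReal_ne_top ?_
    have h2 : Summable fun j : ℕ => 1 / (j : ℝ) ^ 2 :=
      Real.summable_one_div_nat_pow.2 one_lt_two
    refine (summable_congr_cofinite ?_).2 h2
    rw [Nat.cofinite_eq_atTop]
    filter_upwards [eventually_gt_atTop 0] with j hj
    simp [hj.ne']
  filter_upwards [ae_eventually_notMem hsum] with ω hω
  filter_upwards [hω] with j hj k hk
  by_contra hcon
  exact hj ⟨k, by omega, not_lt.1 hcon⟩

/-- Upper half of the law of the iterated logarithm, one-sided. -/
theorem ae_eventually_sum_le (hX : ∀ i, StronglyMeasurable (X i)) (hind : iIndepFun X μ)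
    (hB0 : 0 < B) (hB : ∀ i ω, |X i ω| ≤ B) (hmean : ∀ i, ∫ ω, X i ω ∂μ = 0) :
    ∀ᵐ ω ∂μ, ∀ᶠ k : ℕ in atTop,
      ∑ i ∈ Finset.range k, X i ω ≤ 4 * B * Real.sqrt (k * Real.log (Real.log k)) := by
  filter_upwards [ae_eventually_forall_sum_lt hX hind hB0 hB hmean] with ω hω
  have hj : Tendsto (fun k : ℕ => Nat.log 2 k + 1) atTop atTop := by
    refine tendsto_atTop_mono (fun k => Nat.le_succ _) ?_
    refine tendsto_atTop.2 fun b => ?_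
    filter_upwards [eventually_ge_atTop (2 ^ b)] with k hk
    exact Nat.le_log_of_pow_le one_lt_two hk
  have hlogk : Tendsto (fun k : ℕ => Real.log (k : ℝ)) atTop atTop :=
    Real.tendsto_log_atTop.comp tendsto_natCast_atTop_atTop
  filter_upwards [hj.eventually hω, eventually_ge_atTop 1, hlogk.eventually_ge_atTop 3]
    with k hk hk1 hl
  obtain ⟨m, rfl⟩ : ∃ m, k = m + 1 := ⟨k - 1, by omega⟩
  set k := m + 1 with hkdef
  have h1 := hk m (by have := Nat.lt_pow_succ_log_self one_lt_two k; simp at this ⊢; omega)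
  refine h1.le.trans ?_
  have hkpos : (0 : ℝ) < k := by positivity
  have hpow : ((2 : ℝ) ^ (Nat.log 2 k + 1)) ≤ 2 * k := by
    have : 2 ^ Nat.log 2 k ≤ k := Nat.pow_log_le_self 2 (by omega)
    have h' : ((2 : ℝ) ^ Nat.log 2 k) ≤ k := by exact_mod_cast this
    rw [pow_succ]; linarith
  have hlog2 : (Nat.log 2 k : ℝ) * Real.log 2 ≤ Real.log k := by
    rw [← Real.log_pow]
    apply Real.log_le_log (by positivity)
    exact_mod_cast Nat.pow_log_le_self 2 (by omega)
  -- Since `log k ≥ 3`, the block index is at most `log k / 0.69 + 1 ≤ (log k) ^ 2`, so its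
  -- logarithm is at most `2 log log k`. With `2 ^ j ≤ 2 k` this doubles the constant `2 * B`.
  have hl2 : (0.69 : ℝ) < Real.log 2 := by have := Real.log_two_gt_d9; linarith
  have hjle : ((Nat.log 2 k + 1 : ℕ) : ℝ) ≤ Real.log k ^ 2 := by
    push_cast
    have : (Nat.log 2 k : ℝ) * 0.69 ≤ Real.log k :=
      (mul_le_mul_of_nonneg_left hl2.le (by positivity)).trans hlog2
    nlinarith
  have hloglog : Real.log ((Nat.log 2 k + 1 : ℕ) : ℝ) ≤ 2 * Real.log (Real.log k) := by
    have := Real.log_le_log (by positivity) hjle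
    rwa [Real.log_pow] at this
  have hlog0 : 0 ≤ Real.log ((Nat.log 2 k + 1 : ℕ) : ℝ) := Real.log_natCast_nonneg _
  have : Real.sqrt (2 ^ (Nat.log 2 k + 1) * Real.log ((Nat.log 2 k + 1 : ℕ) : ℝ))
      ≤ 2 * Real.sqrt (k * Real.log (Real.log k)) := by
    rw [show (2 : ℝ) = Real.sqrt (2 ^ 2) by simp, ← Real.sqrt_mul (by positivity)]
    apply Real.sqrt_le_sqrt
    rw [show Real.sqrt (2 ^ 2) = (2 : ℝ) by simp]
    nlinarith [mul_le_mul hpow hloglog hlog0 (by positivity)]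
  nlinarith

/-- Upper half of the law of the iterated logarithm for bounded centred independent variables. -/
theorem ae_sum_isBigO (hX : ∀ i, StronglyMeasurable (X i)) (hind : iIndepFun X μ)
    (hB0 : 0 < B) (hB : ∀ i ω, |X i ω| ≤ B) (hmean : ∀ i, ∫ ω, X i ω ∂μ = 0) :
    ∀ᵐ ω ∂μ, (fun k : ℕ => ∑ i ∈ Finset.range k, X i ω) =O[atTop]
      fun k : ℕ => Real.sqrt (k * Real.log (Real.log k)) := by
  have hneg := ae_eventually_sum_le (X := fun i ω => -X i ω) (μ := μ) (fun i => (hX i).neg)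
    (hind.comp (fun _ x => -x) fun _ => measurable_neg) hB0 (by simpa using hB)
    (fun i => by rw [integral_neg, hmean, neg_zero])
  filter_upwards [ae_eventually_sum_le hX hind hB0 hB hmean, hneg] with ω h1 h2
  refine IsBigO.of_bound (4 * B) ?_
  filter_upwards [h1, h2] with k hk1 hk2
  rw [Real.norm_eq_abs, Real.norm_eq_abs, abs_of_nonneg (Real.sqrt_nonneg _), abs_le]
  rw [Finset.sum_neg_distrib] at hk2
  exact ⟨by linarith, hk1⟩

end MaximalInequality

/-! ### Contraction over one excitation window. -/

section Window

variable {E : Type*} [NormedAddCommGroup E] [InnerProductSpace ℝ E]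

theorem norm_inner_smul_le {M A a : ℝ} {u : E} (v : E) (hu : ‖u‖ ≤ M) (ha : |a| ≤ A) :
    ‖(a * inner ℝ u v) • u‖ ≤ A * M ^ 2 * ‖v‖ := by
  have hM : 0 ≤ M := (norm_nonneg u).trans hu
  have hA : 0 ≤ A := (abs_nonneg a).trans ha
  rw [norm_smul, norm_mul, Real.norm_eq_abs, Real.norm_eq_abs]
  calc |a| * |inner ℝ u v| * ‖u‖ ≤ A * (M * ‖v‖) * M := by
        gcongr
        exact (abs_real_inner_le_norm u v).trans (by gcongr)
    _ = A * M ^ 2 * ‖v‖ := by ring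

variable {φ ψ r : ℕ → E} {a α ρ : ℕ → ℝ} {M A δ : ℝ} {N m₁ : ℕ}

/-- Over a window of fixed length the iterates move by `O(1 / m)`. -/
theorem exists_norm_window_sub_le
    (hrec : ∀ k, ψ (k + 1) = ψ k - (a (k + 1) / ((k + 1 : ℕ) : ℝ) * inner ℝ (φ (k + 1)) (ψ k)) •
      φ (k + 1) + (1 / ((k + 1 : ℕ) : ℝ)) • r (k + 1))
    (hφ : ∀ k, ‖φ (k + 1)‖ ≤ M) (ha : ∀ k, |a (k + 1)| ≤ A) (hm₁ : 1 ≤ m₁)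
    (hρ : ∀ m, m₁ ≤ m → ∀ i < N, ‖r (m + i + 1)‖ ≤ ρ m) (i : ℕ) (hi : i ≤ N) :
    ∃ c, 0 ≤ c ∧ ∀ m, m₁ ≤ m → ‖ψ (m + i) - ψ m‖ ≤ c * (‖ψ m‖ + ρ m) / m := by
  have hP : 0 ≤ A * M ^ 2 := mul_nonneg ((abs_nonneg _).trans (ha 0)) (sq_nonneg M)
  set P := A * M ^ 2
  induction i with
  | zero => exact ⟨0, le_rfl, fun m _ => by simp⟩
  | succ i ih =>
    obtain ⟨c, hc, h⟩ := ih (by omega)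
    refine ⟨c + P * (1 + c) + 1, by positivity, fun m hm => ?_⟩
    have hm1 : (1 : ℝ) ≤ m := by exact_mod_cast hm₁.trans hm
    have hρm := hρ m hm i (by omega)
    have hρ0 : 0 ≤ ρ m := (norm_nonneg _).trans hρm
    have hD := h m hm
    set x := ‖ψ m‖
    have hx : 0 ≤ x := norm_nonneg _
    have hk : (m : ℝ) ≤ ((m + i + 1 : ℕ) : ℝ) := by push_cast; linarith [(Nat.cast_nonneg i : (0:ℝ) ≤ i)]
    have hkpos : (0 : ℝ) < ((m + i + 1 : ℕ) : ℝ) := by linarith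
    have hnorm : ‖ψ (m + i)‖ ≤ (1 + c) * (x + ρ m) := by
      have h1 : ‖ψ (m + i)‖ ≤ x + ‖ψ (m + i) - ψ m‖ := by
        have := norm_add_le (ψ m) (ψ (m + i) - ψ m)
        simpa using this
      have h2 : c * (x + ρ m) / m ≤ c * (x + ρ m) := div_le_self (by positivity) hm1
      nlinarith
    have hstep1 : ‖(a (m + i + 1) / ((m + i + 1 : ℕ) : ℝ) * inner ℝ (φ (m + i + 1)) (ψ (m + i))) •
        φ (m + i + 1)‖ ≤ P * ((1 + c) * (x + ρ m)) / m := by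
      have h1 := norm_inner_smul_le (ψ (m + i)) (hφ (m + i)) (ha (m + i))
      rw [div_mul_eq_mul_div, div_eq_inv_mul, mul_smul, norm_smul, Real.norm_eq_abs,
        abs_of_nonneg (by positivity), ← div_eq_inv_mul]
      gcongr
      exact h1.trans (by gcongr)
    have hstep2 : ‖(1 / ((m + i + 1 : ℕ) : ℝ)) • r (m + i + 1)‖ ≤ (x + ρ m) / m := by
      rw [norm_smul, Real.norm_eq_abs, abs_of_nonneg (by positivity), one_div, ← div_eq_inv_mul]
      gcongr
      linarith
    have hψ : ψ (m + (i + 1)) - ψ m = (ψ (m + i) - ψ m)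
        - (a (m + i + 1) / ((m + i + 1 : ℕ) : ℝ) * inner ℝ (φ (m + i + 1)) (ψ (m + i))) •
          φ (m + i + 1) + (1 / ((m + i + 1 : ℕ) : ℝ)) • r (m + i + 1) := by
      rw [← add_assoc, hrec (m + i)]; abel
    rw [hψ]
    refine (norm_add_le _ _).trans ((add_le_add_left (norm_sub_le _ _) _).trans ?_)
    calc _ ≤ c * (x + ρ m) / m + P * ((1 + c) * (x + ρ m)) / m + (x + ρ m) / m := by gcongr
      _ = _ := by ring

/-- Over a window of fixed length the iterates follow the averaged linear map up to
`O(1 / m ^ 2)`. -/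
theorem exists_norm_window_sub_linear_le
    (hrec : ∀ k, ψ (k + 1) = ψ k - (a (k + 1) / ((k + 1 : ℕ) : ℝ) * inner ℝ (φ (k + 1)) (ψ k)) •
      φ (k + 1) + (1 / ((k + 1 : ℕ) : ℝ)) • r (k + 1))
    (hφ : ∀ k, ‖φ (k + 1)‖ ≤ M) (ha : ∀ k, |a (k + 1)| ≤ A) (hm₁ : 1 ≤ m₁)
    (hρ : ∀ m, m₁ ≤ m → ∀ i < N, ‖r (m + i + 1)‖ ≤ ρ m) (i : ℕ) (hi : i ≤ N) :
    ∃ c, 0 ≤ c ∧ ∀ m, m₁ ≤ m →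
      ‖ψ (m + i) - (ψ m - (1 / (m : ℝ)) • ∑ l ∈ Finset.range i,
        (a (m + l + 1) * inner ℝ (φ (m + l + 1)) (ψ m)) • φ (m + l + 1))‖
        ≤ c * (‖ψ m‖ / m ^ 2 + ρ m / m) := by
  have hP : 0 ≤ A * M ^ 2 := mul_nonneg ((abs_nonneg _).trans (ha 0)) (sq_nonneg M)
  induction i with
  | zero => exact ⟨0, le_rfl, fun m _ => by simp⟩
  | succ i ih =>
    obtain ⟨c, hc, h⟩ := ih (by omega)
    obtain ⟨c', hc', h'⟩ := exists_norm_window_sub_le hrec hφ ha hm₁ hρ i (by omega)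
    set P := A * M ^ 2 with hPdef
    refine ⟨c + (P * c' + P * (i + 1) + 1), by positivity, fun m hm => ?_⟩
    have hm1 : (1 : ℝ) ≤ m := by exact_mod_cast hm₁.trans hm
    have hρm := hρ m hm i (by omega)
    have hρ0 : 0 ≤ ρ m := (norm_nonneg _).trans hρm
    have hD := h m hm
    have hD' := h' m hm
    have hk : (m : ℝ) ≤ ((m + i + 1 : ℕ) : ℝ) := by push_cast; linarith [(Nat.cast_nonneg i : (0:ℝ) ≤ i)]
    have hkpos : (0 : ℝ) < ((m + i + 1 : ℕ) : ℝ) := by linarith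
    have hmpos : (0 : ℝ) < m := by linarith
    set b := a (m + i + 1)
    set u := φ (m + i + 1)
    set κ := ((m + i + 1 : ℕ) : ℝ) with hκ
    -- Three new errors: the drift of the iterate inside the window, the replacement of the step
    -- size by `1 / m`, and the perturbation.
    have key : ψ (m + (i + 1)) - (ψ m - (1 / (m : ℝ)) • ∑ l ∈ Finset.range (i + 1),
        (a (m + l + 1) * inner ℝ (φ (m + l + 1)) (ψ m)) • φ (m + l + 1))
        = (ψ (m + i) - (ψ m - (1 / (m : ℝ)) • ∑ l ∈ Finset.range i,
        (a (m + l + 1) * inner ℝ (φ (m + l + 1)) (ψ m)) • φ (m + l + 1)))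
        + (-(κ⁻¹ • ((b * inner ℝ u (ψ (m + i) - ψ m)) • u))
          + ((1 / m - κ⁻¹) • ((b * inner ℝ u (ψ m)) • u)) + κ⁻¹ • r (m + i + 1)) := by
      rw [Finset.sum_range_succ, ← add_assoc, hrec (m + i), inner_sub_right]
      simp only [← hκ, smul_add, smul_smul, sub_smul, mul_sub, one_div]
      rw [show b / κ * inner ℝ u (ψ (m + i)) = κ⁻¹ * (b * inner ℝ u (ψ (m + i))) by ring]
      module
    rw [key]
    have hκinv : κ⁻¹ ≤ (m : ℝ)⁻¹ := inv_anti₀ hmpos hk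
    have hκpos : 0 ≤ κ⁻¹ := by positivity
    have e1 : ‖-(κ⁻¹ • ((b * inner ℝ u (ψ (m + i) - ψ m)) • u))‖
        ≤ P * c' * (‖ψ m‖ / m ^ 2 + ρ m / m) := by
      rw [norm_neg, norm_smul, Real.norm_eq_abs, abs_of_nonneg hκpos]
      have h1 := norm_inner_smul_le (ψ (m + i) - ψ m) (hφ (m + i)) (ha (m + i))
      calc _ ≤ (m : ℝ)⁻¹ * (P * (c' * (‖ψ m‖ + ρ m) / m)) := by
            gcongr
            exact h1.trans (by gcongr)
        _ = P * c' * (‖ψ m‖ / m ^ 2 + ρ m / m / m) := by field_simp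
        _ ≤ _ := by
            gcongr
            exact div_le_self (by positivity) hm1
    have e2 : ‖(1 / m - κ⁻¹) • ((b * inner ℝ u (ψ m)) • u)‖
        ≤ P * (i + 1) * (‖ψ m‖ / m ^ 2 + ρ m / m) := by
      have h1 := norm_inner_smul_le (ψ m) (hφ (m + i)) (ha (m + i))
      have h2 : 1 / m - κ⁻¹ ≤ (i + 1) / (m : ℝ) ^ 2 := by
        have h3 : (1 : ℝ) / m - κ⁻¹ = (i + 1) / (m * κ) := by
          rw [hκ] at hkpos ⊢
          field_simp
          push_cast
          ring
        rw [h3, sq]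
        gcongr
      have h0 : 0 ≤ 1 / m - κ⁻¹ := by rw [one_div]; linarith
      rw [norm_smul, Real.norm_eq_abs, abs_of_nonneg h0]
      calc _ ≤ ((i + 1) / (m : ℝ) ^ 2) * (P * ‖ψ m‖) := by gcongr
        _ = P * (i + 1) * (‖ψ m‖ / m ^ 2) := by ring
        _ ≤ _ := by
            gcongr
            exact le_add_of_nonneg_right (by positivity)
    have e3 : ‖κ⁻¹ • r (m + i + 1)‖ ≤ 1 * (‖ψ m‖ / m ^ 2 + ρ m / m) := by
      rw [norm_smul, Real.norm_eq_abs, abs_of_nonneg hκpos]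
      calc _ ≤ (m : ℝ)⁻¹ * ρ m := by gcongr
        _ = ρ m / m := by ring
        _ ≤ _ := by
            rw [one_mul]
            exact le_add_of_nonneg_left (by positivity)
    rw [add_mul, add_mul, add_mul]
    exact (norm_add_le _ _).trans (add_le_add hD
      (norm_add₃_le.trans (add_le_add (add_le_add e1 e2) e3)))

/-- Contraction over a window for a stochastic approximation recursion with persistently exciting
regressors. -/
theorem exists_norm_window_le
    (hrec : ∀ k, ψ (k + 1) = ψ k - (a (k + 1) / ((k + 1 : ℕ) : ℝ) * inner ℝ (φ (k + 1)) (ψ k)) •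
      φ (k + 1) + (1 / ((k + 1 : ℕ) : ℝ)) • r (k + 1))
    (hφ : ∀ k, ‖φ (k + 1)‖ ≤ M) (ha : ∀ k, |a (k + 1)| ≤ A) (hδ : 0 < δ) (hN : 1 ≤ N)
    (hexc : ∀ m v, N * δ * ‖v‖ ^ 2 ≤ ∑ i ∈ Finset.range N, inner ℝ (φ (m + i + 1)) v ^ 2)
    (hα : ∀ᶠ m in atTop, ∀ i < N, α m ≤ a (m + i + 1))
    (hα0 : ∀ᶠ m in atTop, 0 ≤ α m)
    (hρ : ∀ᶠ m in atTop, ∀ i < N, ‖r (m + i + 1)‖ ≤ ρ m) :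
    ∃ c, 0 ≤ c ∧ ∀ᶠ m : ℕ in atTop, 0 ≤ 1 - N * (δ * α m) / m + c / m ^ 2 ∧
      ‖ψ (m + N)‖ ≤ (1 - N * (δ * α m) / m + c / m ^ 2) * ‖ψ m‖ + c * (ρ m / m) := by
  obtain ⟨m₁, hm₁⟩ := eventually_atTop.1 (hρ.and (eventually_ge_atTop 1))
  have hA : 0 ≤ A := (abs_nonneg _).trans (ha 0)
  obtain ⟨c, hc, h⟩ := exists_norm_window_sub_linear_le hrec hφ ha (hm₁ m₁ le_rfl).2
    (fun m hm => (hm₁ m hm).1) N le_rfl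
  set P := A * M ^ 2 with hPdef
  have hP : 0 ≤ P := by positivity
  -- The term `(N * P) ^ 2` bounds the squared linear displacement; `c` is the linearization error.
  refine ⟨(N * P) ^ 2 + c, by positivity, ?_⟩
  filter_upwards [hα, hα0, eventually_ge_atTop m₁,
    tendsto_natCast_atTop_atTop.eventually_ge_atTop (N * (δ * A) : ℝ), eventually_ge_atTop 1]
    with m hαm hα0m hm hmA hm1
  have hmpos : (0 : ℝ) < m := by exact_mod_cast hm1
  have hαA : α m ≤ A := (hαm 0 (by omega)).trans ((le_abs_self _).trans (ha _))
  have hy : N * (δ * α m) / m ≤ 1 := by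
    rw [div_le_one hmpos]
    exact le_trans (by gcongr) hmA
  have hq0 : 0 ≤ (N * P) ^ 2 / (m : ℝ) ^ 2 := by positivity
  have hc0 : 0 ≤ c / (m : ℝ) ^ 2 := by positivity
  have hsplit : ((N * P) ^ 2 + c) / (m : ℝ) ^ 2 = (N * P) ^ 2 / (m : ℝ) ^ 2 + c / (m : ℝ) ^ 2 :=
    add_div _ _ _
  have hρ0 : 0 ≤ ρ m / m := div_nonneg ((norm_nonneg _).trans ((hm₁ m hm).1 0 (by omega))) hmpos.le
  refine ⟨by rw [hsplit]; linarith, ?_⟩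
  set v := ψ m
  set S := ∑ l ∈ Finset.range N, (a (m + l + 1) * inner ℝ (φ (m + l + 1)) v) • φ (m + l + 1)
    with hS
  have hSnorm : ‖S‖ ≤ N * P * ‖v‖ := by
    refine (norm_sum_le_of_le _ fun l _ =>
      norm_inner_smul_le v (hφ (m + l)) (ha (m + l))).trans ?_
    simp [mul_assoc, hPdef]
  have hSinner : N * (δ * α m) * ‖v‖ ^ 2 ≤ inner ℝ v S := by
    rw [hS, inner_sum]
    calc N * (δ * α m) * ‖v‖ ^ 2 = α m * (N * δ * ‖v‖ ^ 2) := by ring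
      _ ≤ α m * ∑ i ∈ Finset.range N, inner ℝ (φ (m + i + 1)) v ^ 2 := by
          gcongr; exact hexc m v
      _ ≤ _ := by
          rw [Finset.mul_sum]
          refine Finset.sum_le_sum fun i hi => ?_
          rw [inner_smul_right, real_inner_comm, mul_assoc, ← sq]
          exact mul_le_mul_of_nonneg_right (hαm i (Finset.mem_range.1 hi)) (sq_nonneg _)
  have hlin : ‖v - (1 / (m : ℝ)) • S‖
      ≤ (1 - N * (δ * α m) / m + (N * P) ^ 2 / m ^ 2) * ‖v‖ := by
    refine le_of_sq_le_sq ?_ (mul_nonneg (by linarith) (norm_nonneg _))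
    rw [norm_sub_sq_real, inner_smul_right, norm_smul, Real.norm_eq_abs,
      abs_of_nonneg (by positivity)]
    have h1 : (1 / (m : ℝ) * ‖S‖) ^ 2 ≤ (N * P) ^ 2 / m ^ 2 * ‖v‖ ^ 2 := by
      calc _ ≤ (1 / (m : ℝ) * (N * P * ‖v‖)) ^ 2 := by gcongr
        _ = _ := by ring
    have h2 : N * (δ * α m) / m * ‖v‖ ^ 2 ≤ 1 / (m : ℝ) * inner ℝ v S := by
      calc _ = 1 / (m : ℝ) * (N * (δ * α m) * ‖v‖ ^ 2) := by ring
        _ ≤ _ := by gcongr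
    set y := N * (δ * α m) / m
    set q := (N * P) ^ 2 / (m : ℝ) ^ 2
    -- Expanding the square bounds the left side by `(1 - 2 y + q) ‖v‖ ^ 2`, and `(1 - y + q) ^ 2 -
    -- (1 - 2 y + q) = q + (y - q) ^ 2`.
    have h3 : 0 ≤ (q * 1 + (y - q) ^ 2) * ‖v‖ ^ 2 := by positivity
    nlinarith
  have h1 : ‖ψ (m + N)‖ ≤ ‖v - (1 / (m : ℝ)) • S‖ + c * (‖v‖ / m ^ 2 + ρ m / m) := by
    have := norm_add_le (v - (1 / (m : ℝ)) • S) (ψ (m + N) - (v - (1 / (m : ℝ)) • S))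
    rw [add_sub_cancel] at this
    exact this.trans (by gcongr; exact h m hm)
  refine h1.trans ?_
  rw [hsplit]
  have h4 : c * (‖v‖ / m ^ 2) = c / m ^ 2 * ‖v‖ := by ring
  have h5 : 0 ≤ (N * P) ^ 2 * (ρ m / m) := by positivity
  nlinarith

end Window

/-! ### Supersolutions for the delayed scalar recursion. -/

section Comparison

/-- Comparison with a supersolution of a delayed linear recursion. -/
theorem isBigO_of_supersolution {x g q s : ℕ → ℝ} {N : ℕ} {ε : ℝ} (hN : 1 ≤ N)
    (hx0 : ∀ m, 0 ≤ x m) (hs : ∀ᶠ m in atTop, 0 ≤ s m) (hε : 0 < ε)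
    (hx : ∀ᶠ m in atTop, 0 ≤ q m ∧ x (m + N) ≤ q m * x m + s m)
    (hg : ∀ᶠ m in atTop, 0 < g m)
    (hsup : ∀ᶠ m in atTop, q m * g m + ε * s m ≤ g (m + N)) : x =O[atTop] g := by
  obtain ⟨m₁, hm₁⟩ := eventually_atTop.1 (hx.and (hg.and (hsup.and hs)))
  -- Large enough to dominate the `N` initial values, which a delay of `N` requires, and to give `b
  -- * ε ≥ 1`, which absorbs the source.
  set b : ℝ := 1 / ε + ∑ i ∈ Finset.range N, x (m₁ + i) / g (m₁ + i) with hb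
  have hterm : ∀ i, 0 ≤ x (m₁ + i) / g (m₁ + i) := fun i =>
    div_nonneg (hx0 _) (hm₁ _ (by omega)).2.1.le
  have hsum : 0 ≤ ∑ i ∈ Finset.range N, x (m₁ + i) / g (m₁ + i) :=
    Finset.sum_nonneg fun i _ => hterm i
  have hbε : 1 ≤ b * ε := by
    rw [hb, add_mul, one_div, inv_mul_cancel₀ hε.ne']
    nlinarith
  have hb0 : 0 ≤ b := by positivity
  have key : ∀ j, x (m₁ + j) ≤ b * g (m₁ + j) := by
    intro j
    induction j using Nat.strong_induction_on with
    | _ j ih =>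
      by_cases hj : j < N
      · have h1 : x (m₁ + j) / g (m₁ + j) ≤ b := by
          have := Finset.single_le_sum (f := fun i => x (m₁ + i) / g (m₁ + i))
            (fun i _ => hterm i) (Finset.mem_range.2 hj)
          have h2 : 0 ≤ 1 / ε := by positivity
          linarith
        exact (div_le_iff₀ (hm₁ _ (by omega)).2.1).1 h1
      · obtain ⟨i, rfl⟩ : ∃ i, j = i + N := ⟨j - N, by omega⟩
        obtain ⟨⟨hq, hxi⟩, -, hsi, hs0⟩ := hm₁ (m₁ + i) (by omega)
        rw [← add_assoc]
        calc x (m₁ + i + N) ≤ q (m₁ + i) * x (m₁ + i) + s (m₁ + i) := hxi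
          _ ≤ q (m₁ + i) * (b * g (m₁ + i)) + (b * ε) * s (m₁ + i) := by
              gcongr
              · exact ih i (by omega)
              · exact le_mul_of_one_le_left hs0 hbε
          _ = b * (q (m₁ + i) * g (m₁ + i) + ε * s (m₁ + i)) := by ring
          _ ≤ _ := by gcongr
  refine IsBigO.of_bound b ?_
  filter_upwards [eventually_ge_atTop m₁] with m hm
  obtain ⟨j, rfl⟩ : ∃ j, m = m₁ + j := ⟨m - m₁, by omega⟩
  rw [Real.norm_eq_abs, Real.norm_eq_abs, abs_of_nonneg (hx0 _),
    abs_of_pos (hm₁ _ (by omega)).2.1]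
  exact key j

/-- The window recursion `x (m + N) ≤ (1 - N η m / m + c / m ^ 2) x m + c h m / m`. -/
def WindowRecursion (N : ℕ) (x η h : ℕ → ℝ) : Prop :=
  ∃ c, 0 ≤ c ∧ ∀ᶠ m : ℕ in atTop, 0 ≤ 1 - N * η m / m + c / m ^ 2 ∧
    x (m + N) ≤ (1 - N * η m / m + c / m ^ 2) * x m + c * (h m / m)

variable {x η h : ℕ → ℝ} {N : ℕ}

theorem tendsto_const_div_natCast (c : ℝ) : Tendsto (fun m : ℕ => c / (m : ℝ)) atTop (𝓝 0) :=
  tendsto_const_div_atTop_nhds_zero_nat c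

/-- If the contraction rate exceeds the decay rate of the perturbation, the perturbation
dominates. -/
theorem WindowRecursion.isBigO_of_rate_gt (hx : WindowRecursion N x η h) (hN : 1 ≤ N)
    (hx0 : ∀ m, 0 ≤ x m) (hh : ∀ᶠ m in atTop, 0 < h m) {p r : ℝ} (hpr : p < r)
    (hr : ∀ᶠ m in atTop, r ≤ η m)
    (hdec : ∀ᶠ m : ℕ in atTop, (1 - p * N / m) * h m ≤ h (m + N)) : x =O[atTop] h := by
  obtain ⟨c, hc, hx⟩ := hx
  have hNpos : (0 : ℝ) < N := by exact_mod_cast hN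
  -- Half of the gap between the rates pays for the source, the other half for the `c / m`
  -- correction.
  set ε : ℝ := N * (r - p) / 2 / (c + 1) with hε
  have hε0 : 0 < ε := div_pos (by nlinarith) (by linarith)
  refine isBigO_of_supersolution (ε := ε) hN hx0 ?_ hε0 hx hh ?_
  · filter_upwards [hh] with m hm
    positivity
  · have hlim : ∀ᶠ m : ℕ in atTop, c / (m : ℝ) < N * (r - p) / 2 :=
      (tendsto_const_div_natCast c).eventually_lt_const (by nlinarith)
    filter_upwards [hh, hr, hdec, hlim, eventually_gt_atTop 0] with m h1 h2 h3 h4 h5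
    have hm : (0 : ℝ) < m := by exact_mod_cast h5
    refine le_trans ?_ h3
    have e1 : ε * c ≤ N * (r - p) / 2 := by
      rw [hε, div_mul_eq_mul_div, div_le_iff₀ (by linarith)]
      have : 0 ≤ N * (r - p) / 2 := by nlinarith
      nlinarith
    have e2 : -(N * η m) + c / m + ε * c ≤ -(p * N) := by nlinarith
    have e3 : (-(N * η m) + c / m + ε * c) * (h m / m) ≤ -(p * N) * (h m / m) :=
      mul_le_mul_of_nonneg_right e2 (by positivity)
    have e4 : (1 - N * η m / m + c / (m : ℝ) ^ 2) * h m + ε * (c * (h m / m))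
        = h m + (-(N * η m) + c / m + ε * c) * (h m / m) := by field_simp; ring
    rw [e4]
    have e5 : (1 - p * N / m) * h m = h m + -(p * N) * (h m / m) := by field_simp; ring
    rw [e5]
    linarith

/-- Supersolutions of product form `h₀ u`, where `h₀` decays exactly at the contraction rate. -/
theorem WindowRecursion.isBigO_mul (hx : WindowRecursion N x η h) (hN : 1 ≤ N)
    (hx0 : ∀ m, 0 ≤ x m) (hh : ∀ᶠ m in atTop, 0 ≤ h m) {h₀ u w b : ℕ → ℝ} {r : ℝ}
    (hr : ∀ᶠ m in atTop, r - b m ≤ η m) (hh₀ : ∀ᶠ m in atTop, 0 < h₀ m)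
    (hu : ∀ᶠ m in atTop, 0 < u m) (hw : ∀ᶠ m in atTop, 0 ≤ w m)
    (hdec : ∀ᶠ m : ℕ in atTop, (1 - r * N / m) * h₀ m ≤ h₀ (m + N))
    (hinc : ∀ᶠ m : ℕ in atTop, u m + w m / m ≤ u (m + N))
    (hb : ∀ c, 0 ≤ c → ∃ ε > 0, ∀ᶠ m : ℕ in atTop,
      (N * b m + c / m) * u m + ε * c * (h m / h₀ m) ≤ w m / 2) :
    x =O[atTop] fun m => h₀ m * u m := by
  obtain ⟨c, hc, hx⟩ := hx
  have hNpos : (0 : ℝ) < N := by exact_mod_cast hN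
  obtain ⟨ε, hε, hb⟩ := hb c hc
  refine isBigO_of_supersolution (ε := ε) hN hx0 ?_ hε hx ?_ ?_
  · filter_upwards [hh] with m hm
    positivity
  · filter_upwards [hh₀, hu] with m h1 h2
    positivity
  · have hlim : ∀ᶠ m : ℕ in atTop, r * N / (m : ℝ) < 1 / 2 :=
      (tendsto_const_div_natCast _).eventually_lt_const (by norm_num)
    have hN' : Tendsto (fun m : ℕ => m + N) atTop atTop := tendsto_add_atTop_nat N
    filter_upwards [hr, hh₀, hN'.eventually hh₀, hu, hw, hdec, hinc, hb, hlim,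
      eventually_gt_atTop 0] with m h1 h2 h2' h3 h4 h5 h6 h7 h8 h9
    have hm : (0 : ℝ) < m := by exact_mod_cast h9
    have hq : 0 ≤ 1 - r * N / m := by linarith
    have e0 : (1 - r * N / m) * h₀ m * (u m + w m / m) ≤ h₀ (m + N) * u (m + N) :=
      mul_le_mul h5 h6 (by positivity) h2'.le
    refine le_trans ?_ e0
    -- The decay of `h₀` costs at most half of the increment of `u`; hence the `w m / 2` in `hb`.
    have e1 : h₀ m * (w m / m) * (1 / 2) ≤ h₀ m * (w m / m) * (1 - r * N / m) :=
      mul_le_mul_of_nonneg_left (by linarith) (by positivity)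
    have e2 : ((N * b m + c / m) * u m + ε * c * (h m / h₀ m)) * (h₀ m / m)
        ≤ w m / 2 * (h₀ m / m) := mul_le_mul_of_nonneg_right h7 (by positivity)
    have e3 : ((N * b m + c / m) * u m + ε * c * (h m / h₀ m)) * (h₀ m / m)
        = (N * b m / m + c / m ^ 2) * (h₀ m * u m) + ε * (c * (h m / m)) := by
      field_simp
    have e4 : (N * (r - b m) / m) * (h₀ m * u m) ≤ (N * η m / m) * (h₀ m * u m) := by
      gcongr
    have e5 : N * (r - b m) / m = r * N / m - N * b m / m := by ring
    rw [e3] at e2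
    rw [e5] at e4
    have e6 : w m / 2 * (h₀ m / m) = h₀ m * (w m / m) * (1 / 2) := by ring
    rw [e6] at e2
    nlinarith

end Comparison

/-! ### Growth and decay of powers, logarithms and the iterated logarithm scale. -/

section Asymptotic

/-- Bernoulli's inequality for non-positive exponents. -/
theorem one_add_mul_le_rpow_one_add_of_nonpos {s p : ℝ} (hs : -1 < s) (hp : p ≤ 0) :
    1 + p * s ≤ (1 + s) ^ p := by
  have h1 : 0 < 1 + s := by linarith
  rw [Real.rpow_def_of_pos h1]
  have h2 := Real.log_le_sub_one_of_pos h1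
  have h3 := Real.add_one_le_exp (Real.log (1 + s) * p)
  nlinarith

theorem mul_rpow_neg_le_rpow_add {p : ℝ} (hp : 0 ≤ p) (N : ℕ) {m : ℕ} (hm : 0 < m) :
    (1 - p * N / m) * (m : ℝ) ^ (-p) ≤ ((m + N : ℕ) : ℝ) ^ (-p) := by
  have hm' : (0 : ℝ) < m := by exact_mod_cast hm
  have h1 : ((m + N : ℕ) : ℝ) = m * (1 + N / m) := by push_cast; field_simp
  have hs : (0 : ℝ) ≤ N / m := by positivity
  rw [h1, Real.mul_rpow hm'.le (by linarith), mul_comm]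
  gcongr
  have := one_add_mul_le_rpow_one_add_of_nonpos (s := N / m) (p := -p) (by linarith) (by linarith)
  calc 1 - p * N / m = 1 + -p * (N / m) := by ring
    _ ≤ _ := this

/-- Supplies the increments of the bounded increasing factor `1 - m ^ (-κ)`. The `4` collects two
halvings: the power at `m + N` is at least half of that at `m`, and `N / (m + N) ≥ N / (2 m)`. -/
theorem rpow_neg_add_le {κ : ℝ} (hκ : 0 ≤ κ) (N : ℕ) :
    ∀ᶠ m : ℕ in atTop, ((m + N : ℕ) : ℝ) ^ (-κ) + κ * N / 4 * (m : ℝ) ^ (-κ) / m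
      ≤ (m : ℝ) ^ (-κ) := by
  have hlim : ∀ᶠ m : ℕ in atTop, κ * N / (m : ℝ) < 1 / 2 :=
    (tendsto_const_div_natCast _).eventually_lt_const (by norm_num)
  filter_upwards [hlim, eventually_gt_atTop 0, eventually_ge_atTop N] with m h1 h2 h3
  have hm : (0 : ℝ) < m := by exact_mod_cast h2
  have hNm : (N : ℝ) ≤ m := by exact_mod_cast h3
  have hMpos : (0 : ℝ) < m + N := by positivity
  set y := ((m + N : ℕ) : ℝ) ^ (-κ) with hy
  set z := (m : ℝ) ^ (-κ) with hz
  have hzpos : 0 < z := Real.rpow_pos_of_pos hm _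
  have h4 : (1 - κ * N / m) * z ≤ y := mul_rpow_neg_le_rpow_add hκ N h2
  have h5 : z / 2 ≤ y := by nlinarith
  have h6 : y * (1 + κ * (N / (m + N))) ≤ z := by
    have hs : -1 < -((N : ℝ) / (m + N)) := by
      rw [neg_lt_neg_iff, div_lt_one hMpos]; linarith
    have h7 : (m : ℝ) = ((m + N : ℕ) : ℝ) * (1 + -((N : ℝ) / (m + N))) := by
      push_cast; field_simp; ring
    have h8 : z = y * (1 + -((N : ℝ) / (m + N))) ^ (-κ) := by
      rw [hz, hy, ← Real.mul_rpow (by positivity) (by linarith), ← h7]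
    rw [h8]
    gcongr
    have := one_add_mul_le_rpow_one_add_of_nonpos hs (neg_nonpos.2 hκ)
    calc _ = 1 + -κ * -((N : ℝ) / (m + N)) := by ring
      _ ≤ _ := this
  have h9 : (N : ℝ) / m / 2 ≤ N / (m + N) := by
    rw [div_div]
    apply div_le_div_of_nonneg_left (by positivity) hMpos
    linarith
  have h10 : z / 2 * (κ * (N / m / 2)) ≤ y * (κ * (N / (m + N))) := by gcongr
  calc _ = y + z / 2 * (κ * (N / m / 2)) := by ring
    _ ≤ _ := by linarith

theorem tendsto_log_natCast : Tendsto (fun m : ℕ => Real.log (m : ℝ)) atTop atTop :=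
  Real.tendsto_log_atTop.comp tendsto_natCast_atTop_atTop

theorem tendsto_log_log_natCast :
    Tendsto (fun m : ℕ => Real.log (Real.log (m : ℝ))) atTop atTop :=
  Real.tendsto_log_atTop.comp tendsto_log_natCast

/-- The law of the iterated logarithm scale. -/
noncomputable def lilScale (m : ℕ) : ℝ := Real.sqrt (Real.log (Real.log (m : ℝ)) / (m : ℝ))

theorem lilScale_nonneg (m : ℕ) : 0 ≤ lilScale m := Real.sqrt_nonneg _

theorem lilScale_eq (m : ℕ) :
    lilScale m = Real.sqrt (Real.log (Real.log (m : ℝ))) * (m : ℝ) ^ (-(1 / 2 : ℝ)) := by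
  rw [lilScale, Real.sqrt_div' _ (Nat.cast_nonneg m), Real.rpow_neg (Nat.cast_nonneg m),
    ← Real.sqrt_eq_rpow, div_eq_mul_inv]

theorem eventually_lilScale_pos : ∀ᶠ m in atTop, 0 < lilScale m := by
  filter_upwards [tendsto_log_log_natCast.eventually_gt_atTop 0, eventually_gt_atTop 0] with m h1 h2
  have : (0 : ℝ) < m := by exact_mod_cast h2
  exact Real.sqrt_pos.2 (by positivity)

/-- The iterated logarithm increases, so the scale decays no faster than `m ^ (-1 / 2)`: its
critical contraction rate is `1 / 2`. -/
theorem eventually_lilScale_add_ge (N : ℕ) :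
    ∀ᶠ m : ℕ in atTop, (1 - 1 / 2 * N / m) * lilScale m ≤ lilScale (m + N) := by
  filter_upwards [tendsto_log_natCast.eventually_ge_atTop 1, eventually_gt_atTop 0] with m h1 h2
  have hm : (0 : ℝ) < m := by exact_mod_cast h2
  rw [lilScale_eq m, lilScale_eq (m + N)]
  have h3 := mul_rpow_neg_le_rpow_add (p := 1 / 2) (by norm_num) N h2
  have h4 : Real.sqrt (Real.log (Real.log (m : ℝ)))
      ≤ Real.sqrt (Real.log (Real.log ((m + N : ℕ) : ℝ))) := by
    apply Real.sqrt_le_sqrt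
    apply Real.log_le_log (by linarith)
    apply Real.log_le_log hm
    push_cast
    linarith [(Nat.cast_nonneg N : (0 : ℝ) ≤ N)]
  calc _ = Real.sqrt (Real.log (Real.log (m : ℝ))) *
        ((1 - 1 / 2 * N / m) * (m : ℝ) ^ (-(1 / 2 : ℝ))) := by ring
    _ ≤ Real.sqrt (Real.log (Real.log (m : ℝ))) * ((m + N : ℕ) : ℝ) ^ (-(1 / 2 : ℝ)) := by gcongr
    _ ≤ _ := by gcongr

theorem eventually_log_add_le (N : ℕ) :
    ∀ᶠ m : ℕ in atTop, Real.log ((m + N : ℕ) : ℝ) ≤ 2 * Real.log (m : ℝ) := by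
  filter_upwards [eventually_ge_atTop (N + 2)] with m hm
  have hm' : ((N : ℝ) + 2) ≤ m := by exact_mod_cast hm
  have hN : (0 : ℝ) ≤ N := Nat.cast_nonneg N
  rw [show (2 : ℝ) * Real.log m = Real.log ((m : ℝ) ^ 2) by rw [Real.log_pow]; norm_num]
  apply Real.log_le_log (by push_cast; linarith)
  push_cast
  nlinarith

theorem eventually_lilScale_add_le (N : ℕ) :
    ∀ᶠ m : ℕ in atTop, ∀ i < N, lilScale (m + i) ≤ 2 * lilScale m := by
  filter_upwards [eventually_log_add_le N, tendsto_log_natCast.eventually_ge_atTop 2,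
    eventually_gt_atTop 0] with m h1 h2 h3 i hi
  have hm : (0 : ℝ) < m := by exact_mod_cast h3
  have hi0 : (0 : ℝ) ≤ i := Nat.cast_nonneg i
  have hiN : (i : ℝ) ≤ N := by exact_mod_cast hi.le
  have h4 : Real.log ((m + i : ℕ) : ℝ) ≤ 2 * Real.log m :=
    (Real.log_le_log (by push_cast; linarith) (by push_cast; linarith)).trans h1
  have h4' : Real.log m ≤ Real.log ((m + i : ℕ) : ℝ) :=
    Real.log_le_log hm (by push_cast; linarith)
  have h5 : Real.log (Real.log ((m + i : ℕ) : ℝ)) ≤ 2 * Real.log (Real.log m) := by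
    rw [show (2 : ℝ) * Real.log (Real.log m) = Real.log (Real.log m ^ 2) by
      rw [Real.log_pow]; norm_num]
    apply Real.log_le_log (by linarith)
    nlinarith
  have hll : 0 ≤ Real.log (Real.log m) := Real.log_nonneg (by linarith)
  rw [lilScale, lilScale, show (2 : ℝ) = Real.sqrt (2 ^ 2) by simp,
    ← Real.sqrt_mul (by positivity)]
  apply Real.sqrt_le_sqrt
  rw [div_le_iff₀ (by push_cast; linarith)]
  have : 2 ^ 2 * (Real.log (Real.log m) / m) * ((m + i : ℕ) : ℝ)
      = 4 * Real.log (Real.log m) + 4 * (Real.log (Real.log m) / m) * i := by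
    push_cast; field_simp
    ring
  rw [this]
  have : 0 ≤ 4 * (Real.log (Real.log (m : ℝ)) / m) * i := by positivity
  linarith

theorem eventually_lilScale_le_rpow {q : ℝ} (hq : q < 1 / 2) :
    ∀ᶠ m : ℕ in atTop, lilScale m ≤ (m : ℝ) ^ (-q) := by
  have h1 : ∀ᶠ x : ℝ in atTop, ‖Real.log x‖ ≤ 1 * ‖x ^ (1 - 2 * q)‖ :=
    (isLittleO_log_rpow_atTop (by linarith)).bound one_pos
  filter_upwards [tendsto_natCast_atTop_atTop.eventually h1,
    tendsto_log_natCast.eventually_ge_atTop 1, eventually_gt_atTop 0] with m h2 h3 h4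
  have hm : (0 : ℝ) < m := by exact_mod_cast h4
  rw [one_mul, Real.norm_eq_abs, Real.norm_eq_abs, abs_of_nonneg (by linarith),
    abs_of_pos (Real.rpow_pos_of_pos hm _)] at h2
  have h5 := Real.log_le_sub_one_of_pos (by linarith : 0 < Real.log (m : ℝ))
  rw [lilScale, Real.sqrt_le_left (Real.rpow_nonneg hm.le _), div_le_iff₀ hm, ← Real.rpow_natCast,
    ← Real.rpow_mul hm.le]
  calc Real.log (Real.log m) ≤ (m : ℝ) ^ (1 - 2 * q) := by linarith
    _ = (m : ℝ) ^ (-q * (2 : ℕ)) * m := by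
        rw [← Real.rpow_add_one hm.ne']; congr 1; push_cast; ring

theorem tendsto_rpow_neg_natCast {p : ℝ} (hp : 0 < p) :
    Tendsto (fun m : ℕ => (m : ℝ) ^ (-p)) atTop (𝓝 0) :=
  (tendsto_rpow_neg_atTop hp).comp tendsto_natCast_atTop_atTop

theorem tendsto_log_rpow_mul_rpow_neg (s : ℝ) {p : ℝ} (hp : 0 < p) :
    Tendsto (fun m : ℕ => Real.log (m : ℝ) ^ s * (m : ℝ) ^ (-p)) atTop (𝓝 0) := by
  have h := (isLittleO_log_rpow_rpow_atTop s hp).tendsto_div_nhds_zero.comp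
    tendsto_natCast_atTop_atTop
  refine h.congr fun m => ?_
  simp only [Function.comp_apply]
  rw [Real.rpow_neg (Nat.cast_nonneg m), div_eq_mul_inv]

end Asymptotic

/-! ### Solving the window recursion in each regime. -/

section Rates

variable {x η : ℕ → ℝ} {N : ℕ}

/-- A logarithmically degenerate contraction rate still forces convergence. -/
theorem WindowRecursion.tendsto_zero (hx : WindowRecursion N x η lilScale) (hN : 1 ≤ N)
    (hx0 : ∀ m, 0 ≤ x m) {c : ℝ} (hc : 0 < c)
    (hη : ∀ᶠ m : ℕ in atTop, c / Real.log (m : ℝ) ≤ η m) : Tendsto x atTop (𝓝 0) := by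
  obtain ⟨c', hc', hx⟩ := hx
  have hNpos : (0 : ℝ) < N := by exact_mod_cast hN
  -- The supersolution `(log m) ^ (-κ)` loses a fraction of at most `N κ / (m log m)` per window,
  -- while contraction yields `2 N κ / (m log m)`; the surplus absorbs the errors.
  set κ := c / 2 with hκ
  have hκ0 : 0 < κ := by positivity
  have hbig : x =O[atTop] fun m : ℕ => Real.log (m : ℝ) ^ (-κ) := by
    refine isBigO_of_supersolution (ε := 1) hN hx0 ?_ one_pos hx ?_ ?_
    · filter_upwards [eventually_lilScale_pos] with m hm
      positivity
    · filter_upwards [tendsto_log_natCast.eventually_gt_atTop 0] with m hm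
      positivity
    · have t1 : Tendsto (fun m : ℕ => c' * (Real.log (m : ℝ) ^ (1 : ℝ) * (m : ℝ) ^ (-1 : ℝ))
          + c' * (Real.log (m : ℝ) ^ (κ + 1) * (m : ℝ) ^ (-(1 / 4) : ℝ))) atTop (𝓝 0) := by
        simpa using ((tendsto_log_rpow_mul_rpow_neg 1 one_pos).const_mul c').add
          ((tendsto_log_rpow_mul_rpow_neg (κ + 1) (by norm_num : (0 : ℝ) < 1 / 4)).const_mul c')
      filter_upwards [hη, t1.eventually_lt_const (by positivity : 0 < N * κ),
        eventually_lilScale_le_rpow (by norm_num : (1 / 4 : ℝ) < 1 / 2),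
        tendsto_log_natCast.eventually_ge_atTop 1, eventually_gt_atTop 0] with m h1 h2 h3 h4 h5
      have hm : (0 : ℝ) < m := by exact_mod_cast h5
      set l := Real.log (m : ℝ) with hl
      have hlpos : 0 < l := by linarith
      set g := l ^ (-κ) with hg
      have hgpos : 0 < g := Real.rpow_pos_of_pos hlpos _
      have hnext : g * (1 - κ * N / (m * l)) ≤ Real.log ((m + N : ℕ) : ℝ) ^ (-κ) := by
        have e1 : Real.log ((m + N : ℕ) : ℝ) ≤ l * (1 + N / (m * l)) := by
          have e2 : ((m + N : ℕ) : ℝ) = m * (1 + N / m) := by push_cast; field_simp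
          have e3 : (0 : ℝ) < 1 + N / m := by positivity
          rw [e2, Real.log_mul hm.ne' e3.ne']
          have := Real.log_le_sub_one_of_pos e3
          have e4 : l * (1 + N / (m * l)) = l + N / m := by field_simp
          rw [e4]
          linarith
        have e5 : 0 < Real.log ((m + N : ℕ) : ℝ) := by
          refine lt_of_lt_of_le hlpos (Real.log_le_log hm (by push_cast; linarith))
        have e6 := Real.rpow_le_rpow_of_nonpos e5 e1 (by linarith : -κ ≤ 0)
        refine le_trans ?_ e6
        have e7 : (0 : ℝ) ≤ N / (m * l) := by positivity
        rw [Real.mul_rpow hlpos.le (by positivity)]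
        gcongr
        have := one_add_mul_le_rpow_one_add_of_nonpos (s := N / (m * l)) (p := -κ)
          (by linarith) (by linarith)
        calc _ = 1 + -κ * (N / (m * l)) := by ring
          _ ≤ _ := this
      refine le_trans ?_ hnext
      have e1 : N * (c / l) / m * g ≤ N * η m / m * g := by gcongr
      have e2 : c' * (lilScale m / m) ≤ c' * ((m : ℝ) ^ (-(1 / 4) : ℝ) / m) := by gcongr
      have e3 : (c' * (l ^ (1 : ℝ) * (m : ℝ) ^ (-1 : ℝ))
          + c' * (l ^ (κ + 1) * (m : ℝ) ^ (-(1 / 4) : ℝ))) * (g / (m * l))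
          ≤ N * κ * (g / (m * l)) := mul_le_mul_of_nonneg_right h2.le (by positivity)
      have e4 : l ^ (κ + 1) * g = l := by
        rw [hg, ← Real.rpow_add hlpos]; simp
      have e5 : (c' * (l ^ (1 : ℝ) * (m : ℝ) ^ (-1 : ℝ))
          + c' * (l ^ (κ + 1) * (m : ℝ) ^ (-(1 / 4) : ℝ))) * (g / (m * l))
          = c' / m ^ 2 * g + c' * ((m : ℝ) ^ (-(1 / 4) : ℝ) / m) := by
        rw [Real.rpow_one, Real.rpow_neg_one]
        calc _ = c' / m ^ 2 * g + c' * ((m : ℝ) ^ (-(1 / 4) : ℝ) / m) * ((l ^ (κ + 1) * g) / l) := by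
              field_simp
          _ = _ := by rw [e4, div_self hlpos.ne', mul_one]
      rw [e5] at e3
      have e6 : N * (c / l) / m * g = 2 * (N * κ * (g / (m * l))) := by
        rw [hκ]; field_simp
      have e7 : g * (1 - κ * N / (m * l)) = g - N * κ * (g / (m * l)) := by ring
      rw [e7]
      nlinarith
  refine hbig.trans_tendsto ?_
  exact (tendsto_rpow_neg_atTop hκ0).comp tendsto_log_natCast

/-- Contraction rate exactly `r < 1 / 2` up to a summable correction. -/
theorem WindowRecursion.isBigO_rpow (hx : WindowRecursion N x η lilScale) (hN : 1 ≤ N)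
    (hx0 : ∀ m, 0 ≤ x m) {r b γ : ℝ} (hr0 : 0 ≤ r) (hr : r < 1 / 2) (hγ : 0 < γ)
    (hη : ∀ᶠ m : ℕ in atTop, r - b * (m : ℝ) ^ (-γ) ≤ η m) :
    x =O[atTop] fun m : ℕ => (m : ℝ) ^ (-r) := by
  have hNpos : (0 : ℝ) < N := by exact_mod_cast hN
  -- Strictly below all three exponents, so `m ^ (-κ)` dominates the gain correction, the `c / m`
  -- term and the noise relative to `m ^ (-r)`.
  set κ := min γ (min 1 (1 / 2 - r)) / 2 with hκ
  have hmin : 0 < min γ (min 1 (1 / 2 - r)) := 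
    lt_min hγ (lt_min one_pos (by linarith))
  have hκ0 : 0 < κ := by positivity
  have hκγ : κ < γ := by have := min_le_left γ (min 1 (1 / 2 - r)); linarith
  have hκ1 : κ < 1 := by
    have := (min_le_right γ (min 1 (1 / 2 - r))).trans (min_le_left _ _); linarith
  have hκr : κ < 1 / 2 - r := by
    have := (min_le_right γ (min 1 (1 / 2 - r))).trans (min_le_right _ _); linarith
  have hlt : ∀ᶠ m : ℕ in atTop, (m : ℝ) ^ (-κ) < 1 :=
    (tendsto_rpow_neg_natCast hκ0).eventually_lt_const one_pos
  have h := hx.isBigO_mul hN hx0 (eventually_lilScale_pos.mono fun _ h => h.le)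
    (h₀ := fun m => (m : ℝ) ^ (-r)) (u := fun m => 1 - (m : ℝ) ^ (-κ))
    (w := fun m => κ * N / 4 * (m : ℝ) ^ (-κ)) (b := fun m => b * (m : ℝ) ^ (-γ)) (r := r) hη
    ?_ ?_ ?_ ?_ ?_ ?_
  · refine h.trans (IsBigO.of_bound 1 ?_)
    filter_upwards [hlt] with m hm
    have h1 : 0 ≤ (m : ℝ) ^ (-κ) := by positivity
    rw [norm_mul, one_mul]
    refine mul_le_of_le_one_right (norm_nonneg _) ?_
    rw [Real.norm_eq_abs, abs_of_nonneg (by linarith)]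
    linarith
  · filter_upwards [eventually_gt_atTop 0] with m hm
    have : (0 : ℝ) < m := by exact_mod_cast hm
    positivity
  · filter_upwards [hlt] with m hm
    linarith
  · exact Eventually.of_forall fun m => by positivity
  · filter_upwards [eventually_gt_atTop 0] with m hm
    exact mul_rpow_neg_le_rpow_add hr0 N hm
  · filter_upwards [rpow_neg_add_le hκ0.le N] with m hm
    linarith
  · intro c hc
    refine ⟨1, one_pos, ?_⟩
    have t : Tendsto (fun m : ℕ => N * |b| * (m : ℝ) ^ (-(γ - κ)) + c * (m : ℝ) ^ (-(1 - κ))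
        + c * (m : ℝ) ^ (-((1 / 2 - r - κ) / 2))) atTop (𝓝 0) := by
      simpa using (((tendsto_rpow_neg_natCast (sub_pos.2 hκγ)).const_mul (N * |b|)).add
        ((tendsto_rpow_neg_natCast (sub_pos.2 hκ1)).const_mul c)).add
        ((tendsto_rpow_neg_natCast (half_pos (sub_pos.2 hκr))).const_mul c)
    filter_upwards [hlt, t.eventually_lt_const (by positivity : 0 < κ * N / 4 / 2),
      eventually_lilScale_le_rpow (by linarith : r + κ + (1 / 2 - r - κ) / 2 < 1 / 2),
      eventually_gt_atTop 0] with m h1 h2 h3 h4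
    have hm : (0 : ℝ) < m := by exact_mod_cast h4
    have hz : 0 < (m : ℝ) ^ (-κ) := by positivity
    have a1 : (m : ℝ) ^ (-γ) = (m : ℝ) ^ (-(γ - κ)) * (m : ℝ) ^ (-κ) := by
      rw [← Real.rpow_add hm]; congr 1; ring
    have a2 : c / (m : ℝ) = c * (m : ℝ) ^ (-(1 - κ)) * (m : ℝ) ^ (-κ) := by
      rw [mul_assoc, ← Real.rpow_add hm, div_eq_mul_inv, ← Real.rpow_neg_one]; congr 2; ring
    have a3 : lilScale m / (m : ℝ) ^ (-r)
        ≤ (m : ℝ) ^ (-((1 / 2 - r - κ) / 2)) * (m : ℝ) ^ (-κ) := by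
      rw [div_le_iff₀ (by positivity), ← Real.rpow_add hm, ← Real.rpow_add hm]
      refine h3.trans_eq ?_
      congr 1; ring
    have a4 : (N * (b * (m : ℝ) ^ (-γ)) + c / m) * (1 - (m : ℝ) ^ (-κ))
        ≤ N * (|b| * (m : ℝ) ^ (-γ)) + c / m := by
      have b1 : N * (b * (m : ℝ) ^ (-γ)) + c / m ≤ N * (|b| * (m : ℝ) ^ (-γ)) + c / m := by
        gcongr
        exact le_abs_self b
      have b2 : 0 ≤ N * (|b| * (m : ℝ) ^ (-γ)) + c / m := by positivity
      nlinarith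
    have a5 : 1 * c * (lilScale m / (m : ℝ) ^ (-r))
        ≤ c * ((m : ℝ) ^ (-((1 / 2 - r - κ) / 2)) * (m : ℝ) ^ (-κ)) := by
      rw [one_mul]; gcongr
    refine (add_le_add a4 a5).trans ?_
    rw [a1, a2]
    have := mul_le_mul_of_nonneg_right h2.le hz.le
    linarith

/-- Contraction rate exactly `1 / 2` up to a summable correction. -/
theorem WindowRecursion.isBigO_log_mul_lilScale (hx : WindowRecursion N x η lilScale)
    (hN : 1 ≤ N) (hx0 : ∀ m, 0 ≤ x m) {b γ : ℝ} (hγ : 0 < γ)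
    (hη : ∀ᶠ m : ℕ in atTop, 1 / 2 - b * (m : ℝ) ^ (-γ) ≤ η m) :
    x =O[atTop] fun m : ℕ => Real.log (m : ℝ) * lilScale m := by
  have hNpos : (0 : ℝ) < N := by exact_mod_cast hN
  -- At resonance noise and homogeneous solution have the same order, and the source accumulates
  -- like `∑ 1 / m`; hence the factor `log m`.
  have h := hx.isBigO_mul hN hx0 (eventually_lilScale_pos.mono fun _ h => h.le)
    (h₀ := lilScale) (u := fun m => Real.log (m : ℝ))
    (w := fun _ => N / 2) (b := fun m => b * (m : ℝ) ^ (-γ)) (r := 1 / 2) hη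
    eventually_lilScale_pos (tendsto_log_natCast.eventually_gt_atTop 0)
    (Eventually.of_forall fun _ => by positivity) (eventually_lilScale_add_ge N) ?_ ?_
  · simpa only [mul_comm] using h
  · filter_upwards [eventually_gt_atTop 0, eventually_ge_atTop N] with m h1 h2
    have hm : (0 : ℝ) < m := by exact_mod_cast h1
    have hNm : (N : ℝ) ≤ m := by exact_mod_cast h2
    have e2 : ((m + N : ℕ) : ℝ) = m * (1 + N / m) := by push_cast; field_simp
    have e3 : (0 : ℝ) < 1 + N / m := by positivity
    rw [e2, Real.log_mul hm.ne' e3.ne']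
    have h3 := Real.one_sub_inv_le_log_of_pos e3
    have h4 : (1 : ℝ) - (1 + (N : ℝ) / m)⁻¹ = N / (m + N) := by field_simp; ring
    have h5 : (N : ℝ) / 2 / m ≤ N / (m + N) := by
      rw [div_div]
      exact div_le_div_of_nonneg_left hNpos.le (by positivity) (by linarith)
    linarith
  · intro c hc
    refine ⟨N / 8 / (c + 1), by positivity, ?_⟩
    have t : Tendsto (fun m : ℕ => N * b * (Real.log (m : ℝ) ^ (1 : ℝ) * (m : ℝ) ^ (-γ))
        + c * (Real.log (m : ℝ) ^ (1 : ℝ) * (m : ℝ) ^ (-1 : ℝ))) atTop (𝓝 0) := by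
      simpa using ((tendsto_log_rpow_mul_rpow_neg 1 hγ).const_mul (N * b)).add
        ((tendsto_log_rpow_mul_rpow_neg 1 one_pos).const_mul c)
    filter_upwards [t.eventually_lt_const (by positivity : 0 < (N : ℝ) / 8),
      eventually_lilScale_pos] with m h1 h2
    rw [div_self h2.ne', mul_one]
    have h3 : N / 8 / (c + 1) * c ≤ (N : ℝ) / 8 := by
      rw [div_mul_eq_mul_div, div_le_iff₀ (by linarith)]
      nlinarith
    rw [Real.rpow_one, Real.rpow_neg_one] at h1
    have h4 : (N * (b * (m : ℝ) ^ (-γ)) + c / m) * Real.log (m : ℝ)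
        = N * b * (Real.log (m : ℝ) * (m : ℝ) ^ (-γ)) + c * (Real.log (m : ℝ) * (m : ℝ)⁻¹) := by
      ring
    rw [h4]
    linarith

end Rates

theorem WindowRecursion.mono {N : ℕ} {x η h h' : ℕ → ℝ} (hx : WindowRecursion N x η h)
    (hh : ∀ᶠ m in atTop, h m ≤ h' m) : WindowRecursion N x η h' := by
  obtain ⟨c, hc, hx⟩ := hx
  refine ⟨c, hc, ?_⟩
  filter_upwards [hx, hh] with m h1 h2
  exact ⟨h1.1, h1.2.trans (by gcongr)⟩

theorem eventually_forall_lt_add (N : ℕ) {p : ℕ → Prop}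
    (hp : ∀ᶠ k in atTop, p k) : ∀ᶠ m in atTop, ∀ i < N, p (m + i) := by
  obtain ⟨m₁, hm₁⟩ := eventually_atTop.1 hp
  filter_upwards [eventually_ge_atTop m₁] with m hm i _
  exact hm₁ _ (by omega)

/-! ### Rates for the vector recursion driven by averaged noise. -/

section Deterministic

variable {E : Type*} [NormedAddCommGroup E] [InnerProductSpace ℝ E]
  {φ ψ T : ℕ → E} {a : ℕ → ℝ} {M A δ : ℝ} {N : ℕ}

/-- The recursion of the averaged-observation process: a linear stochastic approximation step with
gain `a`, driven by the averaged noise `T`. -/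
structure AveragedRecursion (φ ψ T : ℕ → E) (a : ℕ → ℝ) (M A δ : ℝ) (N : ℕ) : Prop where
  step : ∀ k, ψ (k + 1) = ψ k - (a (k + 1) / ((k + 1 : ℕ) : ℝ) *
      inner ℝ (φ (k + 1)) (ψ k + T k)) • φ (k + 1) + (1 / ((k + 1 : ℕ) : ℝ)) • T k
  norm_le : ∀ k, ‖φ (k + 1)‖ ≤ M
  gain_le : ∀ k, |a (k + 1)| ≤ A
  delta_pos : 0 < δ
  window_pos : 1 ≤ N
  excitation : ∀ m v, N * δ * ‖v‖ ^ 2 ≤ ∑ i ∈ Finset.range N, inner ℝ (φ (m + i + 1)) v ^ 2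
  noise : T =O[atTop] lilScale

namespace AveragedRecursion

theorem bound_nonneg (H : AveragedRecursion φ ψ T a M A δ N) : 0 ≤ M :=
  (norm_nonneg _).trans (H.norm_le 0)

theorem windowRecursion (H : AveragedRecursion φ ψ T a M A δ N) {α : ℕ → ℝ}
    (hα : ∀ᶠ m in atTop, ∀ i < N, α m ≤ a (m + i + 1)) (hα0 : ∀ᶠ m in atTop, 0 ≤ α m) :
    WindowRecursion N (fun m => ‖ψ m‖) (fun m => δ * α m) lilScale := by
  obtain ⟨b, hb0, hb⟩ := H.noise.exists_pos
  rw [IsBigOWith] at hb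
  set P := A * M ^ 2 with hP
  have hP0 : 0 ≤ P := mul_nonneg ((abs_nonneg _).trans (H.gain_le 0)) (sq_nonneg M)
  -- The noise inside the inner product is moved into the perturbation, which stays of order
  -- `lilScale` because gains and regressors are bounded.
  set r : ℕ → E := fun j => T (j - 1) - (a j * inner ℝ (φ j) (T (j - 1))) • φ j with hr
  have hrec : ∀ k, ψ (k + 1) = ψ k - (a (k + 1) / ((k + 1 : ℕ) : ℝ) * inner ℝ (φ (k + 1)) (ψ k)) •
      φ (k + 1) + (1 / ((k + 1 : ℕ) : ℝ)) • r (k + 1) := by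
    intro k
    rw [H.step k, hr]
    simp only [Nat.add_sub_cancel, inner_add_right, mul_add, add_smul, smul_sub, smul_smul]
    rw [show a (k + 1) / ((k + 1 : ℕ) : ℝ) * inner ℝ (φ (k + 1)) (T k)
      = 1 / ((k + 1 : ℕ) : ℝ) * (a (k + 1) * inner ℝ (φ (k + 1)) (T k)) by ring]
    abel
  have hrbound : ∀ᶠ m in atTop, ∀ i < N,
      ‖r (m + i + 1)‖ ≤ (1 + P) * (b * (2 * lilScale m)) := by
    obtain ⟨m₁, hm₁⟩ := eventually_atTop.1 hb
    filter_upwards [eventually_lilScale_add_le N, eventually_ge_atTop m₁] with m h1 h2 i hi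
    have h3 : ‖T (m + i)‖ ≤ b * (2 * lilScale m) := by
      refine (hm₁ (m + i) (by omega)).trans ?_
      rw [Real.norm_eq_abs, abs_of_nonneg (lilScale_nonneg _)]
      exact mul_le_mul_of_nonneg_left (h1 i hi) hb0.le
    have h4 := norm_inner_smul_le (T (m + i)) (H.norm_le (m + i)) (H.gain_le (m + i))
    calc ‖r (m + i + 1)‖ ≤ ‖T (m + i)‖ + P * ‖T (m + i)‖ := by
          simp only [hr, Nat.add_sub_cancel]
          exact (norm_sub_le _ _).trans (by gcongr)
      _ = (1 + P) * ‖T (m + i)‖ := by ring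
      _ ≤ _ := by gcongr
  obtain ⟨c, hc, h⟩ := exists_norm_window_le hrec H.norm_le H.gain_le H.delta_pos H.window_pos
    H.excitation hα hα0 hrbound
  set R := (1 + P) * (b * 2) with hR
  have hR0 : 0 ≤ R := by positivity
  refine ⟨c * (1 + R), by positivity, ?_⟩
  filter_upwards [h] with m hm
  have hl : 0 ≤ lilScale m := lilScale_nonneg m
  have h1 : c / (m : ℝ) ^ 2 ≤ c * (1 + R) / (m : ℝ) ^ 2 := by
    gcongr
    nlinarith
  refine ⟨by linarith [hm.1], hm.2.trans ?_⟩
  gcongr ?_ * _ + ?_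
  · linarith
  · have : 0 ≤ c * (lilScale m / m) := by positivity
    calc _ = c * R * (lilScale m / m) := by rw [hR]; ring
      _ ≤ c * (1 + R) * (lilScale m / m) := by nlinarith

theorem tendsto_noise (H : AveragedRecursion φ ψ T a M A δ N) : Tendsto T atTop (𝓝 0) := by
  refine H.noise.trans_tendsto ?_
  refine squeeze_zero' (Eventually.of_forall lilScale_nonneg)
    (eventually_lilScale_le_rpow (by norm_num : (1 / 4 : ℝ) < 1 / 2))
    (tendsto_rpow_neg_natCast (by norm_num))

/-- Logarithmic growth of the error and a gain bounded below by the reciprocal of the error give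
consistency. -/
theorem tendsto_zero (H : AveragedRecursion φ ψ T a M A δ N) {c D : ℝ} (hc : 0 < c)
    (hD : 0 ≤ D) (hgrowth : ∀ k : ℕ, 1 ≤ k → ‖ψ k + T k‖ ≤ D + D * Real.log k)
    (hgain : ∀ k, c / (1 + M * ‖ψ k + T k‖) ≤ a (k + 1)) :
    Tendsto (fun k => ψ k + T k) atTop (𝓝 0) := by
  have hM := H.bound_nonneg
  -- Inside the window `D + D log (m + i) ≤ 3 D log m`, since `log (m + i) ≤ 2 log m` and `log m ≥
  -- 1`.
  set c' := c / (1 + M * (3 * D)) with hc'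
  have hc'0 : 0 < c' := by positivity
  have hwin := H.windowRecursion (α := fun m => c' / Real.log (m : ℝ)) ?_ ?_
  · have hψ : Tendsto (fun m => ‖ψ m‖) atTop (𝓝 0) := by
      refine hwin.tendsto_zero H.window_pos (fun _ => norm_nonneg _)
        (c := δ * c') (mul_pos H.delta_pos hc'0) ?_
      exact Eventually.of_forall fun m => by rw [mul_div_assoc]
    simpa using (tendsto_zero_iff_norm_tendsto_zero.2 hψ).add H.tendsto_noise
  · filter_upwards [eventually_log_add_le N, tendsto_log_natCast.eventually_ge_atTop 1,
      eventually_gt_atTop 0] with m h1 h2 h3 i hi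
    have hm : (0 : ℝ) < m := by exact_mod_cast h3
    have hiN : (i : ℝ) ≤ N := by exact_mod_cast hi.le
    refine le_trans ?_ (hgain (m + i))
    have h4 : Real.log ((m + i : ℕ) : ℝ) ≤ 2 * Real.log m :=
      (Real.log_le_log (by push_cast; positivity) (by push_cast; linarith)).trans h1
    have h5 : ‖ψ (m + i) + T (m + i)‖ ≤ 3 * D * Real.log m := by
      refine (hgrowth (m + i) (by omega)).trans ?_
      nlinarith
    rw [hc', div_div]
    apply div_le_div_of_nonneg_left hc.le (by positivity)
    have : M * ‖ψ (m + i) + T (m + i)‖ ≤ M * (3 * D * Real.log m) := by gcongr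
    nlinarith
  · filter_upwards [tendsto_log_natCast.eventually_gt_atTop 0] with m hm
    positivity

theorem isBigO_lilScale (H : AveragedRecursion φ ψ T a M A δ N) {α : ℝ}
    (hα : ∀ᶠ k in atTop, α ≤ a (k + 1)) (hrate : 1 / 2 < δ * α) : ψ =O[atTop] lilScale := by
  have hα0 : 0 ≤ α := by
    by_contra! h
    nlinarith [H.delta_pos]
  have hwin := H.windowRecursion (α := fun _ => α) (eventually_forall_lt_add N hα)
    (Eventually.of_forall fun _ => hα0)
  exact (hwin.isBigO_of_rate_gt H.window_pos (fun _ => norm_nonneg _) eventually_lilScale_pos hrate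
    (Eventually.of_forall fun _ => le_rfl) (eventually_lilScale_add_ge N)).of_norm_left

/-- The noise is majorized by `k ^ (-p)`, whose decay rate `p` lies strictly below the contraction
rate, so this perturbation dominates. -/
theorem isBigO_rpow_of_lt (H : AveragedRecursion φ ψ T a M A δ N) {α p : ℝ}
    (hα : ∀ᶠ k in atTop, α ≤ a (k + 1)) (hp0 : 0 ≤ p) (hp : p < 1 / 2) (hrate : p < δ * α) :
    ψ =O[atTop] fun k : ℕ => (k : ℝ) ^ (-p) := by
  have hα0 : 0 ≤ α := by
    by_contra! h
    nlinarith [H.delta_pos]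
  have hwin := (H.windowRecursion (α := fun _ => α) (eventually_forall_lt_add N hα)
    (Eventually.of_forall fun _ => hα0)).mono (eventually_lilScale_le_rpow hp)
  refine (hwin.isBigO_of_rate_gt H.window_pos (fun _ => norm_nonneg _) ?_ hrate
    (Eventually.of_forall fun _ => le_rfl) ?_).of_norm_left
  · filter_upwards [eventually_gt_atTop 0] with m hm
    have : (0 : ℝ) < m := by exact_mod_cast hm
    positivity
  · filter_upwards [eventually_gt_atTop 0] with m hm
    exact mul_rpow_neg_le_rpow_add hp0 N hm

theorem windowRecursion_of_gain_ge (H : AveragedRecursion φ ψ T a M A δ N) {α b γ : ℝ}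
    (hα0 : 0 < α) (hγ : 0 < γ) (hb : 0 ≤ b)
    (hα : ∀ᶠ k : ℕ in atTop, α - b * (k : ℝ) ^ (-γ) ≤ a (k + 1)) :
    WindowRecursion N (fun m => ‖ψ m‖) (fun m => δ * (α - b * (m : ℝ) ^ (-γ))) lilScale := by
  refine H.windowRecursion ?_ ?_
  · filter_upwards [eventually_forall_lt_add N hα, eventually_gt_atTop 0] with m h1 h2 i hi
    refine le_trans ?_ (h1 i hi)
    have hm : (0 : ℝ) < m := by exact_mod_cast h2
    have : ((m + i : ℕ) : ℝ) ^ (-γ) ≤ (m : ℝ) ^ (-γ) :=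
      Real.rpow_le_rpow_of_nonpos hm (by push_cast; linarith [(Nat.cast_nonneg i : (0 : ℝ) ≤ i)])
        (by linarith)
    nlinarith
  · have t : Tendsto (fun m : ℕ => b * (m : ℝ) ^ (-γ)) atTop (𝓝 0) := by
      simpa using (tendsto_rpow_neg_natCast hγ).const_mul b
    filter_upwards [t.eventually_lt_const hα0] with m hm
    linarith

theorem isBigO_rpow (H : AveragedRecursion φ ψ T a M A δ N) {α b γ : ℝ}
    (hα0 : 0 < α) (hγ : 0 < γ) (hb : 0 ≤ b)
    (hα : ∀ᶠ k : ℕ in atTop, α - b * (k : ℝ) ^ (-γ) ≤ a (k + 1)) (hrate : δ * α < 1 / 2) :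
    ψ =O[atTop] fun k : ℕ => (k : ℝ) ^ (-(δ * α)) := by
  refine ((H.windowRecursion_of_gain_ge hα0 hγ hb hα).isBigO_rpow H.window_pos
    (fun _ => norm_nonneg _) (mul_pos H.delta_pos hα0).le hrate hγ (b := δ * b) ?_).of_norm_left
  exact Eventually.of_forall fun m => by rw [mul_sub, mul_assoc]

theorem isBigO_log_mul_lilScale (H : AveragedRecursion φ ψ T a M A δ N) {α b γ : ℝ}
    (hα0 : 0 < α) (hγ : 0 < γ) (hb : 0 ≤ b)
    (hα : ∀ᶠ k : ℕ in atTop, α - b * (k : ℝ) ^ (-γ) ≤ a (k + 1)) (hrate : δ * α = 1 / 2) :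
    ψ =O[atTop] fun k : ℕ => Real.log (k : ℝ) * lilScale k := by
  refine ((H.windowRecursion_of_gain_ge hα0 hγ hb hα).isBigO_log_mul_lilScale H.window_pos
    (fun _ => norm_nonneg _) hγ (b := δ * b) ?_).of_norm_left
  exact Eventually.of_forall fun m => by rw [mul_sub, mul_assoc, hrate]

end AveragedRecursion

end Deterministic

/-! ### Secant slopes of a monotone function. -/

section Secant

/-- The secant slope of `F` between `z - s` and `z`, with value `K` on the diagonal. -/
noncomputable def secantSlope (F : ℝ → ℝ) (K z s : ℝ) : ℝ :=
  if s = 0 then K else (F z - F (z - s)) / s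

variable {F : ℝ → ℝ} {K z s : ℝ}

theorem secantSlope_mul : secantSlope F K z s * s = F z - F (z - s) := by
  rw [secantSlope]
  split_ifs with h
  · simp [h]
  · field_simp

theorem le_secantSlope {c : ℝ} (hcK : c ≤ K)
    (hF : ∀ x y, z - |s| ≤ x → x ≤ y → y ≤ z + |s| → c * (y - x) ≤ F y - F x) :
    c ≤ secantSlope F K z s := by
  rw [secantSlope]
  split_ifs with h
  · exact hcK
  · rcases lt_or_gt_of_ne h with hs | hs
    · rw [abs_of_neg hs] at hF
      have := hF z (z - s) (by linarith) (by linarith) (by linarith)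
      rw [le_div_iff_of_neg hs]
      linarith
    · rw [abs_of_pos hs] at hF
      have := hF (z - s) z (by linarith) (by linarith) (by linarith)
      rw [le_div_iff₀ hs]
      linarith

theorem secantSlope_nonneg (hF : Monotone F) (hK : 0 ≤ K) : 0 ≤ secantSlope F K z s :=
  le_secantSlope hK fun x y _ hxy _ => by linarith [hF hxy]

theorem secantSlope_le (hF : ∀ x y, |F x - F y| ≤ K * |x - y|) : secantSlope F K z s ≤ K := by
  rw [secantSlope]
  split_ifs with h
  · exact le_rfl
  · refine (le_abs_self _).trans ?_
    rw [abs_div, div_le_iff₀ (abs_pos.2 h)]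
    simpa using hF z (z - s)

/-- For a long secant only the unit interval next to `z` is counted, monotonicity covering the rest.
The slope then decays no faster than `1 / |s|`, which is affordable under logarithmic growth of the
error. -/
theorem div_one_add_le_secantSlope {c : ℝ} (hmono : Monotone F) (hc : 0 < c) (hcK : c ≤ K)
    (hF : ∀ x y, z - 1 ≤ x → x ≤ y → y ≤ z + 1 → c * (y - x) ≤ F y - F x) :
    c / (1 + |s|) ≤ secantSlope F K z s := by
  rcases le_or_gt |s| 1 with hs | hs
  · refine (div_le_self hc.le (by linarith [abs_nonneg s])).trans (le_secantSlope hcK ?_)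
    exact fun x y h1 h2 h3 => hF x y (by linarith) h2 (by linarith)
  · have hpos : 0 < |s| := by linarith
    have hs0 : s ≠ 0 := abs_pos.1 hpos
    have h1 : c / (1 + |s|) ≤ c / |s| := div_le_div_of_nonneg_left hc.le hpos (by linarith)
    refine h1.trans ?_
    rw [secantSlope, if_neg hs0]
    rcases lt_or_gt_of_ne hs0 with h | h
    · rw [abs_of_neg h] at hs ⊢
      have h2 := hF z (z + 1) (by linarith) (by linarith) (by linarith)
      have h3 := hmono (by linarith : z + 1 ≤ z - s)
      rw [← neg_div_neg_eq (F z - F (z - s))]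
      exact div_le_div_of_nonneg_right (by linarith) (by linarith)
    · rw [abs_of_pos h] at hs ⊢
      have h2 := hF (z - 1) z (by linarith) (by linarith) (by linarith)
      have h3 := hmono (by linarith : z - s ≤ z - 1)
      exact div_le_div_of_nonneg_right (by linarith) (by linarith)

end Secant

/-! ### Distribution function of the noise and almost sure size of its averages. -/

section Noise

variable {Ω : Type*} [MeasurableSpace Ω] {μ : Measure Ω}
  {d : ℕ → Ω → ℝ} {f : ℝ → ℝ}

theorem NoiseAssumption.aemeasurable (hd : NoiseAssumption μ d f) {k : ℕ} (hk : 1 ≤ k) :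
    AEMeasurable (d k) μ := (hd.identDistrib k hk).aemeasurable_fst

theorem NoiseAssumption.isProbabilityMeasure_map [IsProbabilityMeasure μ] (hd : NoiseAssumption μ d f) :
    IsProbabilityMeasure (μ.map (d 1)) :=
  Measure.isProbabilityMeasure_map (hd.aemeasurable le_rfl)

theorem monotone_noiseCDF : Monotone (noiseCDF μ d) := monotone_cdf _

theorem abs_noiseCDF_sub_le_one (x : ℝ) {s : ℝ} (hs : 0 ≤ s) (hs' : s ≤ 1) :
    |noiseCDF μ d x - s| ≤ 1 := by
  have h0 : 0 ≤ noiseCDF μ d x := cdf_nonneg _ x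
  have h1 : noiseCDF μ d x ≤ 1 := cdf_le_one _ x
  rw [abs_le]
  constructor <;> linarith

theorem observation_mem {Ω : Type*} {d : ℕ → Ω → ℝ} {n : ℕ} (φ : ℕ → EuclideanSpace ℝ (Fin n))
    (θ : EuclideanSpace ℝ (Fin n)) (C : ℝ) (k : ℕ) (ω : Ω) :
    0 ≤ observation d φ θ C k ω ∧ observation d φ θ C k ω ≤ 1 := by
  rw [observation]
  split_ifs <;> norm_num

/-- A lower bound of the density on an interval bounds the increment of the distribution
function. -/
theorem NoiseAssumption.mul_sub_le [IsProbabilityMeasure μ] (hd : NoiseAssumption μ d f) {c x y : ℝ} (hxy : x ≤ y)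
    (hc : ∀ t ∈ Icc x y, c ≤ f t) :
    c * (y - x) ≤ noiseCDF μ d y - noiseCDF μ d x := by
  have hmono := monotone_noiseCDF (μ := μ) (d := d) hxy
  rcases le_or_gt c 0 with hc0 | hc0
  · nlinarith
  · have := hd.isProbabilityMeasure_map
    have h1 : (μ.map (d 1)) (Ioc x y) = ENNReal.ofReal (noiseCDF μ d y - noiseCDF μ d x) := by
      rw [← measure_cdf (μ.map (d 1)), StieltjesFunction.measure_Ioc]
      simp [noiseCDF]
    have h2 : ENNReal.ofReal (c * (y - x)) ≤ (μ.map (d 1)) (Ioc x y) := by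
      rw [hd.density, withDensity_apply _ measurableSet_Ioc, ENNReal.ofReal_mul hc0.le,
        ← Real.volume_Ioc, ← setLIntegral_const]
      refine setLIntegral_mono' measurableSet_Ioc fun t ht => ?_
      exact ENNReal.ofReal_le_ofReal (hc t (Ioc_subset_Icc_self ht))
    rw [h1] at h2
    exact (ENNReal.ofReal_le_ofReal_iff (by linarith)).1 h2

theorem NoiseAssumption.density_nonneg (hd : NoiseAssumption μ d f) (t : ℝ) : 0 ≤ f t := by
  obtain ⟨c, hc, h⟩ := hd.density_pos (Ioo (t - 1) (t + 1)) isOpen_Ioo (Metric.isBounded_Ioo _ _)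
  exact hc.le.trans (h t ⟨by linarith, by linarith⟩)

theorem NoiseAssumption.exists_pos_le (hd : NoiseAssumption μ d f) (C R : ℝ) :
    ∃ c > 0, ∀ t ∈ Icc (C - R) (C + R), c ≤ f t := by
  obtain ⟨c, hc, h⟩ := hd.density_pos (Ioo (C - R - 1) (C + R + 1)) isOpen_Ioo
    (Metric.isBounded_Ioo _ _)
  exact ⟨c, hc, fun t ht => h t ⟨by linarith [ht.1], by linarith [ht.2]⟩⟩

/-- The normalized sums of the observation errors obey the law of the iterated logarithm. -/
theorem NoiseAssumption.averagedNoise_isBigO [IsProbabilityMeasure μ] (hd : NoiseAssumption μ d f) {n : ℕ}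
    {φ : ℕ → EuclideanSpace ℝ (Fin n)} {M : ℝ} (hφ : ∀ k, ‖φ (k + 1)‖ ≤ M)
    (θ : EuclideanSpace ℝ (Fin n)) (C β : ℝ) :
    ∀ᵐ ω ∂μ, (fun k => averagedNoise μ d φ θ C β k ω) =O[atTop] lilScale := by
  have hprob := hd.isProbabilityMeasure_map
  have hM : 0 ≤ M := (norm_nonneg _).trans (hφ 0)
  have hae : ∀ k, AEMeasurable (d (k + 1)) μ := fun k => hd.aemeasurable (by omega)
  -- The noise is only a.e. measurable, so measurable versions are used.
  set d' : ℕ → Ω → ℝ := fun k => (hae k).mk (d (k + 1)) with hd'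
  have hd'eq : ∀ k, d (k + 1) =ᵐ[μ] d' k := fun k => (hae k).ae_eq_mk
  have hd'ind : iIndepFun d' μ := hd.indep.congr hd'eq
  set g : Fin n → ℕ → ℝ → ℝ := fun j i x =>
    β * (noiseCDF μ d (C - inner ℝ (φ (i + 1)) θ) -
      (Iic (C - inner ℝ (φ (i + 1)) θ)).indicator 1 x) * φ (i + 1) j with hg
  have hgm : ∀ j i, Measurable (g j i) := fun j i =>
    (((measurable_one.indicator measurableSet_Iic).const_sub _).const_mul β).mul_const _
  have hind01 : ∀ (s : Set ℝ) (x : ℝ), 0 ≤ s.indicator (1 : ℝ → ℝ) x ∧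
      s.indicator (1 : ℝ → ℝ) x ≤ 1 := fun s x => by
    by_cases h : x ∈ s <;> simp [h]
  -- The `+ 1` keeps the bound positive even when `β` or `M` vanishes.
  have hgb : ∀ j i x, |g j i x| ≤ |β| * M + 1 := by
    intro j i x
    have h1 := abs_noiseCDF_sub_le_one (μ := μ) (d := d) (C - inner ℝ (φ (i + 1)) θ)
      (hind01 (Iic (C - inner ℝ (φ (i + 1)) θ)) x).1 (hind01 _ x).2
    have h2 : |φ (i + 1) j| ≤ M := (PiLp.norm_apply_le (φ (i + 1)) j).trans (hφ i)
    rw [hg]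
    simp only [abs_mul]
    calc _ ≤ |β| * 1 * M := by gcongr
      _ ≤ _ := by linarith
  have hgmean : ∀ j i, ∫ ω, g j i (d' i ω) ∂μ = 0 := by
    intro j i
    set z := C - inner ℝ (φ (i + 1)) θ with hz
    have hmap : μ.map (d' i) = μ.map (d 1) := by
      rw [← Measure.map_congr (hd'eq i)]
      exact (hd.identDistrib (i + 1) (by omega)).map_eq
    have hd'm : Measurable (d' i) := (hae i).measurable_mk
    rw [← integral_map (f := g j i) hd'm.aemeasurable (hgm j i).aestronglyMeasurable, hmap]
    have hint : Integrable ((Iic z).indicator (1 : ℝ → ℝ)) (μ.map (d 1)) :=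
      (integrable_const (1 : ℝ)).indicator measurableSet_Iic
    simp only [hg]
    rw [integral_mul_const, integral_const_mul, integral_sub (integrable_const _) hint,
      integral_indicator_one measurableSet_Iic, ← cdf_eq_real]
    simp [noiseCDF, hz]
  have hcoord : ∀ j, ∀ᵐ ω ∂μ, (fun k : ℕ => ∑ i ∈ Finset.range k, g j i (d' i ω)) =O[atTop]
      fun k : ℕ => Real.sqrt (k * Real.log (Real.log k)) := fun j =>
    ae_sum_isBigO (X := fun i ω => g j i (d' i ω))
      (fun i => ((hgm j i).comp (hae i).measurable_mk).stronglyMeasurable)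
      (hd'ind.comp (g j) (hgm j)) (by positivity) (fun i ω => hgb j i _) (hgmean j)
  filter_upwards [ae_all_iff.2 hcoord, ae_all_iff.2 hd'eq] with ω h1 h2
  have hpi : (fun k => (averagedNoise μ d φ θ C β k ω).ofLp) =O[atTop] lilScale := by
    refine isBigO_pi.2 fun j => ?_
    have h3 : (fun k : ℕ => 1 / (k : ℝ) * ∑ i ∈ Finset.range k, g j i (d' i ω)) =O[atTop]
        fun k : ℕ => 1 / (k : ℝ) * Real.sqrt (k * Real.log (Real.log k)) :=
      (isBigO_refl _ _).mul (h1 j)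
    refine h3.congr' ?_ ?_
    · refine Eventually.of_forall fun k => ?_
      simp only [averagedNoise, PiLp.smul_apply, WithLp.ofLp_sum, Finset.sum_apply, smul_eq_mul]
      congr 1
      rw [← Finset.Ico_succ_right_eq_Icc, Finset.sum_Ico_eq_sum_range]
      refine Finset.sum_congr (by simp) fun i _ => ?_
      rw [add_comm 1 i]
      simp only [hg, observation, output, ← h2, indicator,
        mem_Iic, Pi.one_apply, le_sub_iff_add_le']
      congr
    · filter_upwards [eventually_gt_atTop 0] with k hk
      have hkpos : (0 : ℝ) < k := by exact_mod_cast hk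
      rw [lilScale, one_div, ← Real.sqrt_sq hkpos.le, ← Real.sqrt_inv, Real.sqrt_sq hkpos.le,
        ← Real.sqrt_mul (by positivity)]
      congr 1
      field_simp
  exact ((PiLp.continuousLinearEquiv 2 ℝ (fun _ : Fin n => ℝ)).symm.toContinuousLinearMap.isBigO_comp
    _ _).trans hpi

end Noise

/-! ### Lower bounds for the density near the central interval. -/

section LowerDensity

variable {n : ℕ} {f : ℝ → ℝ} {C M : ℝ} {θ : EuclideanSpace ℝ (Fin n)}

theorem exists_gt_forall_lt (hf : ∀ t, 0 ≤ f t) (hM : 0 ≤ M) {c : ℝ}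
    (hc : c < lowerDensity f C M θ 0) :
    ∃ R > M * ‖θ‖, ∀ t ∈ Icc (C - R) (C + R), c < f t := by
  have ht := tendsto_lowerDensity hf C hM θ le_rfl
  rw [add_zero] at ht
  obtain ⟨R, hR, hRlt⟩ := ((ht.eventually_const_lt hc).and self_mem_nhdsWithin).exists
  refine ⟨R, hRlt, fun t htR => hR.trans_le ?_⟩
  exact csInf_le ⟨0, by rintro _ ⟨u, -, rfl⟩; exact hf u⟩ ⟨t, htR, rfl⟩

theorem lowerDensity_le (hf : ∀ t, 0 ≤ f t) (hM : 0 ≤ M) {t : ℝ}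
    (ht : t ∈ Icc (C - M * ‖θ‖) (C + M * ‖θ‖)) : lowerDensity f C M θ 0 ≤ f t := by
  have hlim := tendsto_lowerDensity hf C hM θ le_rfl
  rw [add_zero] at hlim
  refine le_of_tendsto hlim ?_
  filter_upwards [self_mem_nhdsWithin] with R hR
  have hR' : M * ‖θ‖ < R := hR
  exact csInf_le ⟨0, by rintro _ ⟨u, -, rfl⟩; exact hf u⟩
    ⟨t, ⟨by linarith [ht.1], by linarith [ht.2]⟩, rfl⟩

theorem le_lowerDensity (hf : ∀ t, 0 ≤ f t) (hM : 0 ≤ M) {c R : ℝ} (hR : M * ‖θ‖ < R)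
    (hc : ∀ t ∈ Icc (C - R) (C + R), c ≤ f t) : c ≤ lowerDensity f C M θ 0 := by
  have hlim := tendsto_lowerDensity hf C hM θ le_rfl
  rw [add_zero] at hlim
  have h0 : 0 ≤ M * ‖θ‖ := by positivity
  refine ge_of_tendsto hlim ?_
  filter_upwards [Ioo_mem_nhdsGT hR] with z hz
  refine le_csInf ⟨f C, C, ⟨by linarith [hz.1], by linarith [hz.1]⟩, rfl⟩ ?_
  rintro _ ⟨t, ht, rfl⟩
  exact hc t ⟨by linarith [ht.1, hz.2], by linarith [ht.2, hz.2]⟩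

/-- For a locally Lipschitz density the lower bound degrades at most linearly outside of the
interval. -/
theorem exists_lowerDensity_sub_le (hf : ∀ t, 0 ≤ f t) (hM : 0 ≤ M) (hlip : LocallyLipschitz f) :
    ∃ L, 0 ≤ L ∧ ∀ s, 0 ≤ s → s ≤ 1 →
      ∀ t ∈ Icc (C - M * ‖θ‖ - s) (C + M * ‖θ‖ + s), lowerDensity f C M θ 0 - L * s ≤ f t := by
  set R := M * ‖θ‖ with hR
  have hR0 : 0 ≤ R := by positivity
  obtain ⟨L, hL⟩ := LocallyLipschitzOn.exists_lipschitzOnWith_of_compact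
    (isCompact_Icc (a := C - R - 1) (b := C + R + 1)) hlip.locallyLipschitzOn
  refine ⟨L, L.2, fun s hs0 hs1 t ht => ?_⟩
  -- The point of the central interval nearest to `t`.
  set u := max (C - R) (min t (C + R)) with hu
  have hu1 : C - R ≤ u := le_max_left _ _
  have hu2 : u ≤ C + R := max_le (by linarith) (min_le_right _ _)
  have hut : |u - t| ≤ s := by
    rw [abs_le, hu]
    rcases le_total t (C + R) with h | h
    · rw [min_eq_left h]
      rcases le_total (C - R) t with h' | h'
      · rw [max_eq_right h']; constructor <;> linarith
      · rw [max_eq_left h']; constructor <;> linarith [ht.1]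
    · rw [min_eq_right h, max_eq_right (by linarith)]
      constructor <;> linarith [ht.2]
  have h1 := lowerDensity_le (θ := θ) hf hM ⟨hu1, hu2⟩
  have h2 := hL.dist_le_mul u ⟨by linarith, by linarith⟩ t ⟨by linarith [ht.1], by linarith [ht.2]⟩
  rw [Real.dist_eq, Real.dist_eq] at h2
  have h3 : (L : ℝ) * |u - t| ≤ L * s := by gcongr
  have h4 := le_abs_self (f u - f t)
  linarith

end LowerDensity

/-- The Loewner inequality evaluated as a quadratic form at `v`. -/
theorem PersistentExcitation.sum_inner_sq_ge {n : ℕ} {φ : ℕ → EuclideanSpace ℝ (Fin n)}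
    {M δ : ℝ} {N : ℕ} (hφ : PersistentExcitation φ M δ N) (m : ℕ)
    (v : EuclideanSpace ℝ (Fin n)) :
    N * δ * ‖v‖ ^ 2 ≤ ∑ i ∈ Finset.range N, inner ℝ (φ (m + i + 1)) v ^ 2 := by
  have hN : (0 : ℝ) < N := by exact_mod_cast hφ.window_pos
  have h := (hφ.excitation (m + 1) (by omega)).dotProduct_mulVec_nonneg v.ofLp
  have hinner : ∀ i, inner ℝ (φ i) v = (φ i).ofLp ⬝ᵥ v.ofLp := fun i => by
    rw [EuclideanSpace.inner_eq_star_dotProduct, dotProduct_comm]; simp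
  have hnorm : ‖v‖ ^ 2 = v.ofLp ⬝ᵥ v.ofLp := by
    rw [← real_inner_self_eq_norm_sq, EuclideanSpace.inner_eq_star_dotProduct]; simp
  rw [Matrix.sub_mulVec, Matrix.smul_mulVec, Matrix.smul_mulVec, Matrix.one_mulVec,
    Matrix.sum_mulVec, dotProduct_sub, dotProduct_smul, dotProduct_smul, dotProduct_sum] at h
  have hterm : ∀ i, v.ofLp ⬝ᵥ Matrix.mulVec (Matrix.vecMulVec (φ i).ofLp (φ i).ofLp) v.ofLp
      = inner ℝ (φ i) v ^ 2 := fun i => by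
    rw [Matrix.vecMulVec_mulVec, hinner, dotProduct_smul, dotProduct_comm v.ofLp]
    simp [sq]
  simp only [star_trivial, smul_eq_mul, hterm] at h
  rw [← hnorm, Finset.sum_Ico_eq_sum_range] at h
  have h2 : ∑ i ∈ Finset.range (m + 1 + N - (m + 1)), inner ℝ (φ (m + 1 + i)) v ^ 2
      = ∑ i ∈ Finset.range N, inner ℝ (φ (m + i + 1)) v ^ 2 := by
    rw [Nat.add_sub_cancel_left]
    exact Finset.sum_congr rfl fun i _ => by rw [add_right_comm]
  rw [h2, sub_nonneg, one_div, ← div_eq_inv_mul, le_div_iff₀ hN] at h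
  linarith

/-! ### The recursion of the averaged-observation process and its rates on a fixed path. -/

section Pathwise

variable {Ω : Type*} [MeasurableSpace Ω] {μ : Measure Ω} {n : ℕ} {d : ℕ → Ω → ℝ} {f : ℝ → ℝ}
  {φ : ℕ → EuclideanSpace ℝ (Fin n)} {θ : EuclideanSpace ℝ (Fin n)}
  {C β M δ : ℝ} {N : ℕ} {θ₀ : Ω → EuclideanSpace ℝ (Fin n)}

theorem spao_add_averagedNoise (k : ℕ) (ω : Ω) :
    spao μ d φ θ C β θ₀ k ω + averagedNoise μ d φ θ C β k ω
      = estimate μ d φ θ C β θ₀ k ω - θ := by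
  rw [spao, sub_add_cancel]

theorem averagedNoise_succ (k : ℕ) (ω : Ω) :
    averagedNoise μ d φ θ C β (k + 1) ω = averagedNoise μ d φ θ C β k ω +
      (1 / ((k + 1 : ℕ) : ℝ)) •
        ((β * (noiseCDF μ d (C - inner ℝ (φ (k + 1)) θ) - observation d φ θ C (k + 1) ω)) •
          φ (k + 1) - averagedNoise μ d φ θ C β k ω) := by
  simp only [averagedNoise]
  rw [Finset.sum_Icc_succ_top (by omega)]
  rcases Nat.eq_zero_or_pos k with rfl | hk
  · simp
  · have hk' : (k : ℝ) ≠ 0 := by exact_mod_cast hk.ne'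
    have hk1 : ((k + 1 : ℕ) : ℝ) ≠ 0 := by positivity
    rw [smul_add, smul_sub, smul_smul (1 / ((k + 1 : ℕ) : ℝ)) (1 / (k : ℝ))]
    have : (1 : ℝ) / ((k + 1 : ℕ) : ℝ) = 1 / k - 1 / ((k + 1 : ℕ) : ℝ) * (1 / k) := by
      field_simp
      push_cast
      ring
    nth_rewrite 1 [this]
    rw [sub_smul]
    abel

/-- The gain of the recursion satisfied by the averaged-observation process. -/
noncomputable def gain (μ : Measure Ω) (d : ℕ → Ω → ℝ) (φ : ℕ → EuclideanSpace ℝ (Fin n))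
    (θ : EuclideanSpace ℝ (Fin n)) (C β : ℝ) (θ₀ : Ω → EuclideanSpace ℝ (Fin n)) (K : ℝ) (ω : Ω)
    (k : ℕ) : ℝ :=
  β * secantSlope (noiseCDF μ d) K (C - inner ℝ (φ k) θ)
    (inner ℝ (φ k) (estimate μ d φ θ C β θ₀ (k - 1) ω - θ))

/-- The observation cancels between estimate and average, leaving an increment of the distribution
function, which the secant slope makes exactly linear in the error. The diagonal value `K` is free
because it multiplies zero. -/
theorem spao_succ (K : ℝ) (k : ℕ) (ω : Ω) :
    spao μ d φ θ C β θ₀ (k + 1) ω = spao μ d φ θ C β θ₀ k ω -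
      (gain μ d φ θ C β θ₀ K ω (k + 1) / ((k + 1 : ℕ) : ℝ) * inner ℝ (φ (k + 1))
        (spao μ d φ θ C β θ₀ k ω + averagedNoise μ d φ θ C β k ω)) • φ (k + 1) +
      (1 / ((k + 1 : ℕ) : ℝ)) • averagedNoise μ d φ θ C β k ω := by
  have hsec := secantSlope_mul (F := noiseCDF μ d) (K := K) (z := C - inner ℝ (φ (k + 1)) θ)
    (s := inner ℝ (φ (k + 1)) (estimate μ d φ θ C β θ₀ k ω - θ))
  rw [spao_add_averagedNoise, gain, Nat.add_sub_cancel,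
    show ∀ u c : ℝ, β * u / c * inner ℝ (φ (k + 1)) (estimate μ d φ θ C β θ₀ k ω - θ)
      = β / c * (u * inner ℝ (φ (k + 1)) (estimate μ d φ θ C β θ₀ k ω - θ)) by intros; ring, hsec,
    spao, spao, averagedNoise_succ, estimate]
  have hz : C - inner ℝ (φ (k + 1)) θ - inner ℝ (φ (k + 1)) (estimate μ d φ θ C β θ₀ k ω - θ)
      = C - inner ℝ (φ (k + 1)) (estimate μ d φ θ C β θ₀ k ω) := by
    rw [inner_sub_right]; ring
  rw [hz]
  module

/-- Each step has length at most `β M / (k + 1)`, so the total is harmonic. -/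
theorem norm_estimate_sub_le (hβ : 0 ≤ β) (hφ : ∀ k, ‖φ (k + 1)‖ ≤ M) (ω : Ω) {k : ℕ}
    (hk : 1 ≤ k) : ‖estimate μ d φ θ C β θ₀ k ω - θ‖
      ≤ ‖estimate μ d φ θ C β θ₀ 1 ω - θ‖ + β * M * Real.log k := by
  have hM : 0 ≤ M := (norm_nonneg _).trans (hφ 0)
  induction k, hk using Nat.le_induction with
  | base => simp
  | succ k hk ih =>
    have hkpos : (0 : ℝ) < k := by exact_mod_cast hk
    have hk1 : (0 : ℝ) < ((k + 1 : ℕ) : ℝ) := by positivity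
    rw [estimate]
    set v := estimate μ d φ θ C β θ₀ k ω
    have hobs := observation_mem (d := d) φ θ C (k + 1) ω
    have h1 := abs_noiseCDF_sub_le_one (μ := μ) (d := d) (C - inner ℝ (φ (k + 1)) v)
      hobs.1 hobs.2
    have hlog : 1 / ((k + 1 : ℕ) : ℝ) ≤ Real.log ((k + 1 : ℕ) : ℝ) - Real.log k := by
      rw [← Real.log_div hk1.ne' hkpos.ne']
      refine le_trans (le_of_eq ?_) (Real.one_sub_inv_le_log_of_pos (div_pos hk1 hkpos))
      rw [inv_div]
      field_simp
      push_cast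
      ring
    have h2 : ‖(β / ((k + 1 : ℕ) : ℝ) * (noiseCDF μ d (C - inner ℝ (φ (k + 1)) v)
        - observation d φ θ C (k + 1) ω)) • φ (k + 1)‖
        ≤ β * M * (Real.log ((k + 1 : ℕ) : ℝ) - Real.log k) := by
      rw [norm_smul, Real.norm_eq_abs, abs_mul, abs_of_nonneg (by positivity)]
      calc _ ≤ β / ((k + 1 : ℕ) : ℝ) * 1 * M := by gcongr; exact hφ k
        _ = β * M * (1 / ((k + 1 : ℕ) : ℝ)) := by ring
        _ ≤ _ := by gcongr
    rw [add_sub_right_comm]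
    refine (norm_add_le _ _).trans ?_
    linarith

variable [IsProbabilityMeasure μ]

/-- Rates of the averaged-observation process along a path on which the averaged noise obeys the
law of the iterated logarithm. -/
theorem spao_isBigO_of_averagedNoise (hβ : 0 < β) (hφ : PersistentExcitation φ M δ N)
    (hd : NoiseAssumption μ d f) {η : ℝ} (hη : η = β * δ * lowerDensity f C M θ 0) {ω : Ω}
    (hT : (fun k => averagedNoise μ d φ θ C β k ω) =O[atTop] lilScale) :
    0 < η ∧ (1 / 2 < η → (fun k => spao μ d φ θ C β θ₀ k ω) =O[atTop] lilScale) ∧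
      (∀ p, 0 ≤ p → p < 1 / 2 → p < η →
        (fun k => spao μ d φ θ C β θ₀ k ω) =O[atTop] fun k : ℕ => (k : ℝ) ^ (-p)) ∧
      (LocallyLipschitz f →
        (η = 1 / 2 → (fun k => spao μ d φ θ C β θ₀ k ω) =O[atTop]
          fun k : ℕ => Real.log (k : ℝ) * lilScale k) ∧
        (η < 1 / 2 → (fun k => spao μ d φ θ C β θ₀ k ω) =O[atTop]
          fun k : ℕ => (k : ℝ) ^ (-η))) := by
  have hf0 := hd.density_nonneg
  have hφM : ∀ k, ‖φ (k + 1)‖ ≤ M := fun k => hφ.bounded _ (by omega)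
  have hM : 0 ≤ M := (norm_nonneg _).trans (hφM 0)
  set ℓ := lowerDensity f C M θ 0 with hℓ
  set R := M * ‖θ‖ with hR
  have hR0 : 0 ≤ R := by positivity
  obtain ⟨c, hc, hcf⟩ := hd.exists_pos_le C (R + 1)
  have hcℓ : c ≤ ℓ := le_lowerDensity hf0 hM (by linarith : R < R + 1) hcf
  have hℓ0 : 0 < ℓ := hc.trans_le hcℓ
  have hηpos : 0 < η := by rw [hη]; exact mul_pos (mul_pos hβ hφ.delta_pos) hℓ0
  obtain ⟨K₀, hK₀⟩ := hd.cdf_lipschitz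
  -- The diagonal value must be a Lipschitz constant and also at least `ℓ`, so that density lower
  -- bounds pass to a zero-length secant.
  set K : ℝ := K₀ + ℓ with hK
  have hℓK : ℓ ≤ K := by simp [hK]
  have hlip : ∀ x y, |noiseCDF μ d x - noiseCDF μ d y| ≤ K * |x - y| := by
    intro x y
    have h := hK₀.dist_le_mul x y
    rw [Real.dist_eq, Real.dist_eq] at h
    nlinarith [abs_nonneg (x - y)]
  have hmono : Monotone (noiseCDF μ d) := monotone_noiseCDF
  set a := gain μ d φ θ C β θ₀ K ω with ha
  set e := fun k => estimate μ d φ θ C β θ₀ k ω - θ with he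
  have hs : ∀ k, |inner ℝ (φ (k + 1)) (e k)| ≤ M * ‖e k‖ := fun k =>
    (abs_real_inner_le_norm _ _).trans (by gcongr; exact hφM k)
  have hz : ∀ k, |inner ℝ (φ (k + 1)) θ| ≤ R := fun k =>
    (abs_real_inner_le_norm _ _).trans (by rw [hR]; gcongr; exact hφM k)
  have hgain : ∀ k, a (k + 1) = β * secantSlope (noiseCDF μ d) K (C - inner ℝ (φ (k + 1)) θ)
    (inner ℝ (φ (k + 1)) (e k)) := fun k => rfl
  have hgain_ge : ∀ k c', c' ≤ K → (∀ t ∈ Icc (C - R - M * ‖e k‖) (C + R + M * ‖e k‖), c' ≤ f t) →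
      β * c' ≤ a (k + 1) := by
    intro k c' hc'K hc'
    rw [hgain]
    refine mul_le_mul_of_nonneg_left (le_secantSlope hc'K fun x y hx hxy hy => ?_) hβ.le
    refine hd.mul_sub_le hxy fun t ht => hc' t ⟨?_, ?_⟩
    · linarith [ht.1, hs k, (abs_le.1 (hz k)).2]
    · linarith [ht.2, hs k, (abs_le.1 (hz k)).1]
  have hgain_ge' : ∀ k, β * c / (1 + M * ‖e k‖) ≤ a (k + 1) := by
    intro k
    rw [hgain, mul_div_assoc]
    refine mul_le_mul_of_nonneg_left ?_ hβ.le
    refine le_trans ?_ (div_one_add_le_secantSlope hmono hc (hcℓ.trans hℓK) ?_)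
    · apply div_le_div_of_nonneg_left hc.le (by positivity)
      linarith [hs k]
    · intro x y hx hxy hy
      refine hd.mul_sub_le hxy fun t ht => hcf t ⟨?_, ?_⟩
      · linarith [ht.1, (abs_le.1 (hz k)).2]
      · linarith [ht.2, (abs_le.1 (hz k)).1]
  have H : AveragedRecursion φ (fun k => spao μ d φ θ C β θ₀ k ω)
      (fun k => averagedNoise μ d φ θ C β k ω) a M (β * K) δ N :=
    { step := fun k => spao_succ K k ω
      norm_le := hφM
      gain_le := fun k => by
        have h0 := secantSlope_nonneg (z := C - inner ℝ (φ (k + 1)) θ)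
          (s := inner ℝ (φ (k + 1)) (e k)) hmono (hℓ0.le.trans hℓK)
        rw [hgain, abs_mul, abs_of_pos hβ, abs_of_nonneg h0]
        exact mul_le_mul_of_nonneg_left (secantSlope_le hlip) hβ.le
      delta_pos := hφ.delta_pos
      window_pos := hφ.window_pos
      excitation := hφ.sum_inner_sq_ge
      noise := hT }
  have hsum : ∀ k, spao μ d φ θ C β θ₀ k ω + averagedNoise μ d φ θ C β k ω = e k :=
    fun k => spao_add_averagedNoise k ω
  have hcons : Tendsto e atTop (𝓝 0) := by
    have h := H.tendsto_zero (c := β * c) (D := ‖e 1‖ + β * M) (by positivity) (by positivity) ?_ ?_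
    · simpa only [hsum] using h
    · intro k hk
      have hlog : 0 ≤ Real.log (k : ℝ) := Real.log_natCast_nonneg k
      simp only [hsum]
      refine (norm_estimate_sub_le hβ.le hφM ω hk).trans ?_
      have h1 : 0 ≤ ‖e 1‖ * Real.log k := by positivity
      have h2 : 0 ≤ β * M := by positivity
      simp only [he] at h1 ⊢
      nlinarith
    · simpa only [hsum] using hgain_ge'
  have hMe : Tendsto (fun k => M * ‖e k‖) atTop (𝓝 0) := by
    simpa using hcons.norm.const_mul M
  have hrate : ∀ q, q < η → ∃ α, (∀ᶠ k in atTop, α ≤ a (k + 1)) ∧ q < δ * α := by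
    intro q hq
    have hβδ : 0 < β * δ := mul_pos hβ hφ.delta_pos
    have h1 : q / (β * δ) < ℓ := by rw [div_lt_iff₀ hβδ]; linarith
    -- The density exceeds any `c' < ℓ` on a strictly larger interval, which contains the secants
    -- once the error is small.
    obtain ⟨c', hc'1, hc'2⟩ := exists_between h1
    obtain ⟨R', hR', hR'f⟩ := exists_gt_forall_lt hf0 hM hc'2
    refine ⟨β * c', ?_, ?_⟩
    · filter_upwards [hMe.eventually_lt_const (sub_pos.2 hR')] with k hk
      refine hgain_ge k c' (hc'2.le.trans hℓK) fun t ht => (hR'f t ⟨?_, ?_⟩).le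
      · linarith [ht.1]
      · linarith [ht.2]
    · rw [div_lt_iff₀ hβδ] at hc'1
      linarith
  have hpow : ∀ p, 0 ≤ p → p < 1 / 2 → p < η →
      (fun k => spao μ d φ θ C β θ₀ k ω) =O[atTop] fun k : ℕ => (k : ℝ) ^ (-p) := by
    intro p hp0 hp1 hp2
    obtain ⟨α, hα, hq⟩ := hrate p hp2
    exact H.isBigO_rpow_of_lt hα hp0 hp1 hq
  refine ⟨hηpos, fun h => ?_, hpow, fun hLL => ?_⟩
  · obtain ⟨α, hα, hq⟩ := hrate _ h
    exact H.isBigO_lilScale hα hq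
  · obtain ⟨L, hL0, hL⟩ := exists_lowerDensity_sub_le (C := C) (θ := θ) hf0 hM hLL
    -- Bootstrap: the rate `γ`, already available, controls the deficit of the gain.
    set γ := min η (1 / 2) / 2 with hγ
    have hmin : 0 < min η (1 / 2) := lt_min hηpos (by norm_num)
    have hγ0 : 0 < γ := by positivity
    have hγη : γ < η := by linarith [min_le_left η (1 / 2)]
    have hγ2 : γ < 1 / 2 := by linarith [min_le_right η (1 / 2)]
    have hbig : e =O[atTop] fun k : ℕ => (k : ℝ) ^ (-γ) := by
      have h1 := hpow γ hγ0.le hγ2 hγη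
      have h2 : lilScale =O[atTop] fun k : ℕ => (k : ℝ) ^ (-γ) := by
        refine IsBigO.of_bound 1 ?_
        filter_upwards [eventually_lilScale_le_rpow hγ2] with k hk
        rw [one_mul, Real.norm_eq_abs, abs_of_nonneg (lilScale_nonneg k)]
        exact hk.trans (le_abs_self _)
      simpa only [hsum] using h1.add (hT.trans h2)
    obtain ⟨b, hb0, hb⟩ := hbig.exists_pos
    rw [IsBigOWith] at hb
    have hαge : ∀ᶠ k : ℕ in atTop,
        β * ℓ - β * (L * (M * b)) * (k : ℝ) ^ (-γ) ≤ a (k + 1) := by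
      filter_upwards [hb, hMe.eventually_lt_const one_pos] with k hk1 hk2
      rw [Real.norm_eq_abs, abs_of_nonneg (by positivity)] at hk1
      have h1 : 0 ≤ L * (M * ‖e k‖) := by positivity
      refine le_trans ?_ (hgain_ge k (ℓ - L * (M * ‖e k‖)) (by linarith)
        (hL (M * ‖e k‖) (by positivity) hk2.le))
      have h2 : β * (L * (M * ‖e k‖)) ≤ β * (L * (M * (b * (k : ℝ) ^ (-γ)))) := by gcongr
      linarith
    have hδη : δ * (β * ℓ) = η := by rw [hη]; ring
    have hβℓ : 0 < β * ℓ := mul_pos hβ hℓ0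
    have hb' : 0 ≤ β * (L * (M * b)) := by positivity
    refine ⟨fun h => H.isBigO_log_mul_lilScale hβℓ hγ0 hb' hαge (hδη.trans h), fun h => ?_⟩
    have := H.isBigO_rpow hβℓ hγ0 hb' hαge (by rwa [hδη])
    rwa [hδη] at this

end Pathwise

end SetValued

theorem theorem4 {Ω : Type*} [MeasurableSpace Ω] (μ : Measure Ω) [IsProbabilityMeasure μ]
    {n : ℕ} (d : ℕ → Ω → ℝ) (f : ℝ → ℝ)
    (φ : ℕ → EuclideanSpace ℝ (Fin n)) (θ : EuclideanSpace ℝ (Fin n))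
    (C β M δ : ℝ) (N : ℕ) (θ₀ : Ω → EuclideanSpace ℝ (Fin n))
    (hβ : 0 < β)
    (hφ : SetValued.PersistentExcitation φ M δ N)
    (hd : SetValued.NoiseAssumption μ d f)
    (η : ℝ) (hη : η = β * δ * SetValued.lowerDensity f C M θ 0) :
    ((1 / 2 < η → ∀ᵐ ω ∂μ,
        (fun k : ℕ => SetValued.spao μ d φ θ C β θ₀ k ω) =O[atTop]
          fun k : ℕ => Real.sqrt (Real.log (Real.log (k : ℝ)) / (k : ℝ))) ∧
      (η ≤ 1 / 2 → ∀ ε : ℝ, 0 < ε → ∀ᵐ ω ∂μ,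
        (fun k : ℕ => SetValued.spao μ d φ θ C β θ₀ k ω) =O[atTop]
          fun k : ℕ => 1 / (k : ℝ) ^ (η - ε))) ∧
    (LocallyLipschitz f →
      (1 / 2 < η → ∀ᵐ ω ∂μ,
        (fun k : ℕ => SetValued.spao μ d φ θ C β θ₀ k ω) =O[atTop]
          fun k : ℕ => Real.sqrt (Real.log (Real.log (k : ℝ)) / (k : ℝ))) ∧
      (η = 1 / 2 → ∀ᵐ ω ∂μ,
        (fun k : ℕ => SetValued.spao μ d φ θ C β θ₀ k ω) =O[atTop]
          fun k : ℕ => Real.log (k : ℝ) *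
            Real.sqrt (Real.log (Real.log (k : ℝ)) / (k : ℝ))) ∧
      (η < 1 / 2 → ∀ᵐ ω ∂μ,
        (fun k : ℕ => SetValued.spao μ d φ θ C β θ₀ k ω) =O[atTop]
          fun k : ℕ => 1 / (k : ℝ) ^ η)) := by
  have hinv : ∀ p : ℝ, (fun k : ℕ => 1 / (k : ℝ) ^ p) = fun k : ℕ => (k : ℝ) ^ (-p) := fun p => by
    ext k
    rw [Real.rpow_neg (Nat.cast_nonneg k), one_div]
  have hae := (hd.averagedNoise_isBigO (fun k => hφ.bounded (k + 1) (by omega)) θ C β).mono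
    fun ω hω => SetValued.spao_isBigO_of_averagedNoise (θ₀ := θ₀) hβ hφ hd hη hω
  refine ⟨⟨fun h => hae.mono fun ω hω => hω.2.1 h, fun h ε hε => hae.mono fun ω hω => ?_⟩,
    fun hL => ⟨fun h => hae.mono fun ω hω => hω.2.1 h,
      fun h => hae.mono fun ω hω => (hω.2.2.2 hL).1 h,
      fun h => hae.mono fun ω hω => by rw [hinv]; exact (hω.2.2.2 hL).2 h⟩⟩
  have hη0 := hω.1
  -- Truncation at zero covers `ε > η`, since `hω` provides only nonnegative exponents.
  have hmax : max (η - ε) 0 < η := max_lt (by linarith) hη0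
  refine (hω.2.2.1 (max (η - ε) 0) (le_max_right _ _) (by linarith) hmax).trans ?_
  rw [hinv]
  refine IsBigO.of_bound 1 ?_
  filter_upwards [eventually_ge_atTop 1] with k hk
  have hk1 : (1 : ℝ) ≤ k := by exact_mod_cast hk
  rw [one_mul, Real.norm_eq_abs, Real.norm_eq_abs, abs_of_nonneg (by positivity),
    abs_of_nonneg (by positivity)]
  exact Real.rpow_le_rpow_of_exponent_le hk1 (neg_le_neg (le_max_left _ _))
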